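/- Let $X$ be a complex manifold, let $E\to X$ be a holomorphic vector bundle of rank $m$ with a smooth Hermitian metric $\langle\cdot,\cdot\rangle$ (linear in the first argument), let $D$ be the Chern connection of $E$ and $\Theta=D^2$ its curvature. Let $f$ be a holomorphic section of $E$ and $Z=\{f=0\}$. Over $X\setminus Z$ let $S\subset E$ be the line bundle spanned by $f$, let $Q=E/S$ carry the induced Hermitian metric, let $D_Q$ be its Chern connection with curvature $\Theta_Q$, and let $\aleph=i/2\pi$ and $c(D_Q)=\det(I_Q+\aleph\,\Theta_Q)$. Let $\sigma=\langle\cdot,f\rangle/|f|^2$, i.e. the section of $E^*$ over $X\setminus Z$ of minimal norm with $\sigma\cdot f=1$. In the exterior algebra bundle $\Lambda=\Lambda(T^*X\oplus E\oplus E^*)$ (complexified), for a local frame $e_j$ of $E$ with dual frame $e_j^*$, identify an $E$-valued form $\sum_j\xi_j\otimes e_j$ with $\sum_j\xi_j\wedge e_j$, an $E^*$-valued form $\sum_k\eta_k\otimes e_k^*$ with $\sum_k\eta_k\wedge e_k^*$, and an $\mathrm{End}(E)$-valued form $a=\sum_{j,k}a_{jk}\otimes e_j\otimes e_k^*$ with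 $\tilde a=\sum_{j,k}a_{jk}\wedge e_j\wedge e_k^*$; let $I$ be the identity of $E$. Every $\omega$ with values in $\Lambda$ can be written uniquely as $\omega=\omega'\wedge\tilde I^m/m!+\omega''$, where $\omega'$ is a differential form and $\omega''$ has lower degree in $e_j,e_k^*$; put $\int_e\omega=\omega'$. Then on $X\setminus Z$ $$c(D_Q)=\int_e f\wedge\sigma\wedge\exp\big(\tilde I+\aleph\,\tilde\Theta-\aleph\,Df\wedge\bar\partial\sigma\big).$$ -/

import Mathlib

open scoped Manifold ContDiff Bundle

namespace ChernQuotient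

noncomputable section

/-! ### Differential forms at a point, in local holomorphic coordinates `z = (z₁, …, zₙ)` -/

/-- The coordinate space `ℂⁿ`. -/
abbrev Coord (n : ℕ) : Type := EuclideanSpace ℂ (Fin n)

/-- Complex-valued covectors `ℂ ⊗ T*`: real-linear maps from the tangent space `ℂⁿ` to `ℂ`. -/
abbrev Cot (n : ℕ) : Type := Coord n →L[ℝ] ℂ

/-- Complex-valued forms at a point: the complex exterior algebra of `ℂ ⊗ T*`. -/
abbrev Form (n : ℕ) : Type := ExteriorAlgebra ℂ (Cot n)

/-- The constant `ℵ = i / 2π`. -/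
def aleph : ℂ := Complex.I / (2 * Real.pi)

/-- The complex structure `v ↦ i v` of `ℂⁿ`, as a real-linear map. -/
def cplxJ (n : ℕ) : Coord n →L[ℝ] Coord n :=
  (Complex.I • ContinuousLinearMap.id ℂ (Coord n)).restrictScalars ℝ

/-- The `(1,0)`-part (complex-linear part) of a covector. -/
def part10 {n : ℕ} (L : Cot n) : Cot n := (1 / 2 : ℂ) • (L - Complex.I • L.comp (cplxJ n))

/-- The `(0,1)`-part (conjugate-linear part) of a covector. -/
def part01 {n : ℕ} (L : Cot n) : Cot n := (1 / 2 : ℂ) • (L + Complex.I • L.comp (cplxJ n))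

/-- `∂u` at `p`. -/
def del {n : ℕ} (u : Coord n → ℂ) (p : Coord n) : Cot n := part10 (fderiv ℝ u p)

/-- `∂̄u` at `p`. -/
def delbar {n : ℕ} (u : Coord n → ℂ) (p : Coord n) : Cot n := part01 (fderiv ℝ u p)

/-- The coordinate vector `∂/∂xⱼ`, where `zⱼ = xⱼ + i yⱼ`. -/
def vecX {n : ℕ} (j : Fin n) : Coord n := EuclideanSpace.single j 1

/-- The coordinate vector `∂/∂yⱼ`, where `zⱼ = xⱼ + i yⱼ`. -/
def vecY {n : ℕ} (j : Fin n) : Coord n := EuclideanSpace.single j Complex.I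

/-- The covector `dxⱼ`. -/
def dX {n : ℕ} (j : Fin n) : Cot n :=
  Complex.ofRealCLM.comp
    (Complex.reCLM.comp ((EuclideanSpace.proj j : Coord n →L[ℂ] ℂ).restrictScalars ℝ))

/-- The covector `dyⱼ`. -/
def dY {n : ℕ} (j : Fin n) : Cot n :=
  Complex.ofRealCLM.comp
    (Complex.imCLM.comp ((EuclideanSpace.proj j : Coord n →L[ℂ] ℂ).restrictScalars ℝ))

/-- A covector as a form of degree one. -/
def oneForm {n : ℕ} (a : Cot n) : Form n := ExteriorAlgebra.ι ℂ a

/-- The exterior derivative `dα = ∑ⱼ dxⱼ ∧ ∂α/∂xⱼ + dyⱼ ∧ ∂α/∂yⱼ` of a one-form `α`, at `p`. -/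
def extD {n : ℕ} (α : Coord n → Cot n) (p : Coord n) : Form n :=
  ∑ j : Fin n, (oneForm (dX j) * oneForm (fderiv ℝ α p (vecX j))
    + oneForm (dY j) * oneForm (fderiv ℝ α p (vecY j)))

/-! ### Chern connection, curvature and Chern form in a holomorphic frame

A connection `D` is given in a frame `e₁, …, e_r` by its connection matrix `θ` of one-forms,
`D e_k = ∑ⱼ θⱼₖ ⊗ eⱼ`.  A Hermitian metric is given by `Hⱼₖ = ⟨eⱼ, eₖ⟩`. -/

/-- The connection matrix of the Chern connection in a holomorphic frame with Gram matrix `H`: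
`θ = (∂H · H⁻¹)ᵀ`.  See `eq_chernConnection_iff`. -/
def chernConnection {n r : ℕ} (H : Coord n → Matrix (Fin r) (Fin r) ℂ) (p : Coord n) :
    Matrix (Fin r) (Fin r) (Cot n) :=
  Matrix.of fun l j => ∑ k, (H p)⁻¹ k l • del (fun q => H q j k) p

/-- The conjugate of a covector. -/
def conjCot {n : ℕ} (a : Cot n) : Cot n := (Complex.conjCLE : ℂ →L[ℝ] ℂ).comp a

theorem part10_add_part01 {n : ℕ} (L : Cot n) : part10 L + part01 L = L := by
  ext v
  simp only [part10, part01, _root_.add_apply, _root_.sub_apply,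
    _root_.smul_apply, smul_eq_mul]
  ring

theorem cplxJ_cplxJ {n : ℕ} (v : Coord n) : cplxJ n (cplxJ n v) = -v := by
  simp [cplxJ, smul_smul]

/-- `part10` as a complex-linear map. -/
def part10ₗ (n : ℕ) : Cot n →ₗ[ℂ] Cot n where
  toFun := part10
  map_add' L M := by
    ext v
    simp [part10]; ring
  map_smul' c L := by
    ext v
    simp [part10]; ring

theorem part10_part10 {n : ℕ} (L : Cot n) : part10 (part10 L) = part10 L := by
  ext v
  have hI := Complex.I_mul_I
  simp only [part10, _root_.sub_apply, _root_.smul_apply, smul_eq_mul,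
    ContinuousLinearMap.comp_apply, cplxJ_cplxJ, map_neg]
  linear_combination (-(1 / 4 : ℂ)) * L v * hI

theorem part01_conj {n : ℕ} (L : Cot n) : part01 (conjCot L) = conjCot (part10 L) := by
  ext v
  have h2 : (starRingEnd ℂ) (2 : ℂ) = 2 := map_ofNat _ 2
  simp [part10, part01, conjCot, h2]
  ring

theorem part01_of_part10 {n : ℕ} {L : Cot n} (h : part01 L = 0) : part10 L = L := by
  have := part10_add_part01 L
  rwa [h, add_zero] at this

theorem part10_conj {n : ℕ} {L : Cot n} (h : part01 L = 0) : part10 (conjCot L) = 0 := by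
  have h1 := part10_add_part01 (conjCot L)
  rw [part01_conj, part01_of_part10 h] at h1
  simpa using h1

/-- The Chern connection is the unique connection `D = d + θ` that is compatible with the
holomorphic structure (its `(0,1)`-part is `∂̄`, that is, `θ` has type `(1,0)`) and with the
metric: `d⟨eⱼ, eₖ⟩ = ⟨D eⱼ, eₖ⟩ + ⟨eⱼ, D eₖ⟩`. -/
theorem eq_chernConnection_iff {n r : ℕ} (H : Coord n → Matrix (Fin r) (Fin r) ℂ) (p : Coord n)
    (hH : ∀ q, (H q).IsHermitian) (hdet : IsUnit (H p).det)
    (hd : ∀ j k, DifferentiableAt ℝ (fun q => H q j k) p) (θ : Matrix (Fin r) (Fin r) (Cot n)) :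
    θ = chernConnection H p ↔
      (∀ l j, part01 (θ l j) = 0) ∧
      ∀ j k, fderiv ℝ (fun q => H q j k) p
        = ∑ l, H p l k • θ l j + ∑ l, H p j l • conjCot (θ l k) := by
  have hinv1 : ∀ l l', ∑ k, H p l k * (H p)⁻¹ k l' = if l = l' then 1 else 0 := by
    intro l l'
    rw [← Matrix.mul_apply, Matrix.mul_nonsing_inv _ hdet, Matrix.one_apply]
  have hinv2 : ∀ l l', ∑ k, (H p)⁻¹ l k * H p k l' = if l = l' then 1 else 0 := by
    intro l l'
    rw [← Matrix.mul_apply, Matrix.nonsing_inv_mul _ hdet, Matrix.one_apply]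
  have hconjd : ∀ j k, fderiv ℝ (fun q => H q j k) p = conjCot (fderiv ℝ (fun q => H q k j) p) := by
    intro j k
    have h1 : (fun q => H q j k) = fun q => (Complex.conjCLE : ℂ →L[ℝ] ℂ) (H q k j) := by
      funext q
      exact ((hH q).apply j k).symm
    rw [h1]
    exact ((Complex.conjCLE : ℂ →L[ℝ] ℂ).hasFDerivAt.comp p (hd k j).hasFDerivAt).fderiv
  have hHc : ∀ j k, (starRingEnd ℂ) (H p j k) = H p k j := fun j k => (hH p).apply k j
  constructor
  · rintro rfl
    have ht : ∀ l j, part10 (chernConnection H p l j) = chernConnection H p l j := by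
      intro l j
      change part10ₗ n _ = _
      simp only [chernConnection, Matrix.of_apply, map_sum, map_smul]
      refine Finset.sum_congr rfl fun k _ => ?_
      congr 1
      exact part10_part10 _
    have hdel : ∀ j k, ∑ l, H p l k • chernConnection H p l j = del (fun q => H q j k) p := by
      intro j k
      simp only [chernConnection, Matrix.of_apply, Finset.smul_sum, smul_smul]
      rw [Finset.sum_comm]
      simp only [← Finset.sum_smul, mul_comm (H p _ _), hinv2]
      simp
    refine ⟨fun l j => ?_, fun j k => ?_⟩
    · have h1 := part10_add_part01 (chernConnection H p l j)
      rw [ht] at h1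
      simpa using h1
    · have h2 : ∑ l, H p j l • conjCot (chernConnection H p l k)
          = conjCot (del (fun q => H q k j) p) := by
        rw [← hdel]
        ext v
        simp [conjCot, hHc]
      rw [hdel, h2, del, del, ← part01_conj, ← hconjd, part10_add_part01]
  · rintro ⟨ht, hm⟩
    have hdel : ∀ j k, del (fun q => H q j k) p = ∑ l, H p l k • θ l j := by
      intro j k
      have h1 := congrArg (part10ₗ n) (hm j k)
      simp only [map_add, map_sum, map_smul] at h1
      have h2 : ∀ l, part10ₗ n (conjCot (θ l k)) = 0 := fun l => part10_conj (ht l k)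
      have h3 : ∀ l, part10ₗ n (θ l j) = θ l j := fun l => part01_of_part10 (ht l j)
      have h4 : ∑ l, H p j l • part10ₗ n (conjCot (θ l k)) = 0 :=
        Finset.sum_eq_zero fun l _ => by rw [h2]; exact smul_zero (A := Cot n) (H p j l)
      rw [h4] at h1
      simp only [h3] at h1
      exact h1.trans (add_zero _)
    ext1 l' j
    simp only [chernConnection, Matrix.of_apply, hdel, Finset.smul_sum, smul_smul]
    rw [Finset.sum_comm]
    simp only [← Finset.sum_smul, mul_comm ((H p)⁻¹ _ _), hinv1]
    simp

/-- The curvature matrix `Θ = D² = dθ + θ ∧ θ` of the connection with matrix `θ`, so that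
`Θ e_k = ∑ⱼ Θⱼₖ ⊗ eⱼ`. -/
def curvature {n r : ℕ} (θ : Coord n → Matrix (Fin r) (Fin r) (Cot n)) (p : Coord n) :
    Matrix (Fin r) (Fin r) (Form n) :=
  Matrix.of fun j k => extD (fun q => θ q j k) p + ∑ l, oneForm (θ p j l) * oneForm (θ p l k)

/-- The curvature of the Chern connection. -/
def chernCurvature {n r : ℕ} (H : Coord n → Matrix (Fin r) (Fin r) ℂ) (p : Coord n) :
    Matrix (Fin r) (Fin r) (Form n) :=
  curvature (chernConnection H) p

/-- The determinant of a matrix of (commuting) forms of even degree, by the Leibniz formula. -/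
def detForm {n r : ℕ} (M : Matrix (Fin r) (Fin r) (Form n)) : Form n :=
  ∑ τ : Equiv.Perm (Fin r), (Equiv.Perm.sign τ : ℤ) • (List.ofFn fun i => M (τ i) i).prod

/-- The Chern form `c(D) = det(I + ℵ Θ)` of the Chern connection `D`. -/
def chernForm {n r : ℕ} (H : Coord n → Matrix (Fin r) (Fin r) ℂ) (p : Coord n) : Form n :=
  detForm (1 + aleph • chernCurvature H p)

/-! ### The algebra `Λ(T* ⊕ E ⊕ E*)` and the integral `∫ₑ`, over one point

`W` is the fibre of `E` at the point. -/

section Berezin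

variable {n m : ℕ} {W : Type*} [AddCommGroup W] [Module ℂ W]

/-- The fibre of `Λ = Λ(T* ⊕ E ⊕ E*)`. -/
abbrev Lam (n : ℕ) (W : Type*) [AddCommGroup W] [Module ℂ W] : Type _ :=
  ExteriorAlgebra ℂ (Cot n × W × Module.Dual ℂ W)

/-- Forms as elements of `Λ`. -/
def ofForm : Form n →ₐ[ℂ] Lam n W :=
  ExteriorAlgebra.map (LinearMap.inl ℂ (Cot n) (W × Module.Dual ℂ W))

/-- A vector `ξ ∈ E` as an element of `Λ`. -/
def ofVec (ξ : W) : Lam n W := ExteriorAlgebra.ι ℂ (0, ξ, 0)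

/-- A dual vector `η ∈ E*` as an element of `Λ`. -/
def ofDual (η : Module.Dual ℂ W) : Lam n W := ExteriorAlgebra.ι ℂ (0, 0, η)

/-- `ã = ∑ⱼₖ aⱼₖ ∧ eⱼ ∧ eₖ*` for a form-valued endomorphism `a = ∑ⱼₖ aⱼₖ ⊗ eⱼ ⊗ eₖ*`. -/
def tildeEnd (b : Module.Basis (Fin m) ℂ W) (a : Matrix (Fin m) (Fin m) (Form n)) : Lam n W :=
  ∑ j, ∑ k, ofForm (a j k) * ofVec (b j) * ofDual (b.coord k)

/-- `ξ̃ = ∑ⱼ ξⱼ ∧ eⱼ` for an `E`-valued one-form `ξ = ∑ⱼ ξⱼ ⊗ eⱼ`. -/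
def tildeVec (b : Module.Basis (Fin m) ℂ W) (ξ : Fin m → Cot n) : Lam n W :=
  ∑ j, ofForm (oneForm (ξ j)) * ofVec (b j)

/-- `η̃ = ∑ₖ ηₖ ∧ eₖ*` for an `E*`-valued one-form `η = ∑ₖ ηₖ ⊗ eₖ*`. -/
def tildeDual (b : Module.Basis (Fin m) ℂ W) (η : Fin m → Cot n) : Lam n W :=
  ∑ k, ofForm (oneForm (η k)) * ofDual (b.coord k)

/-- The functional reading off the coefficient of `eⱼ`. -/
def readVec (b : Module.Basis (Fin m) ℂ W) (j : Fin m) :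
    Module.Dual ℂ (Cot n × W × Module.Dual ℂ W) :=
  b.coord j ∘ₗ LinearMap.fst ℂ W (Module.Dual ℂ W) ∘ₗ
    LinearMap.snd ℂ (Cot n) (W × Module.Dual ℂ W)

/-- The functional reading off the coefficient of `eⱼ*`. -/
def readDual (b : Module.Basis (Fin m) ℂ W) (j : Fin m) :
    Module.Dual ℂ (Cot n × W × Module.Dual ℂ W) :=
  Module.Dual.eval ℂ W (b j) ∘ₗ LinearMap.snd ℂ W (Module.Dual ℂ W) ∘ₗ
    LinearMap.snd ℂ (Cot n) (W × Module.Dual ℂ W)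

/-- Strip one factor `eⱼ ∧ eⱼ*` from the left: contract with `eⱼ`, then with `eⱼ*`. -/
def strip (b : Module.Basis (Fin m) ℂ W) (j : Fin m) : Module.End ℂ (Lam n W) :=
  CliffordAlgebra.contractLeft (readDual b j) ∘ₗ CliffordAlgebra.contractLeft (readVec b j)

/-- The integral `∫ₑ : Λ → Λ(T*)`: it strips all the factors `eⱼ ∧ eⱼ*` and then annihilates
everything that still contains some vector of `E` or of `E*`.
See `berezin_eq` for the characterization
`∫ₑ (ω' ∧ Ĩ^m / m! + ω'') = ω'` where `ω''` has lower degree in `e, e*`. -/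
def berezin (b : Module.Basis (Fin m) ℂ W) : Lam n W →ₗ[ℂ] Form n :=
  (ExteriorAlgebra.map (LinearMap.fst ℂ (Cot n) (W × Module.Dual ℂ W))).toLinearMap ∘ₗ
    (List.ofFn fun j : Fin m => (strip b j : Module.End ℂ (Lam n W))).prod

/-- The elements of `Λ` of degree `< d` in `e, e*`. -/
def lowDeg (n d : ℕ) (W : Type*) [AddCommGroup W] [Module ℂ W] : Submodule ℂ (Lam n W) :=
  Submodule.span ℂ {w | ∃ (α : Form n) (l : List (W × Module.Dual ℂ W)), l.length < d ∧
    w = ofForm α * (l.map fun u => ExteriorAlgebra.ι ℂ ((0 : Cot n), u)).prod}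

/-- The exponential `∑ a^k / k!` of a nilpotent element (all elements of positive degree of an
exterior algebra of finite dimension are nilpotent). -/
def expNil {A : Type*} [Ring A] [Algebra ℂ A] (a : A) : A :=
  ∑ k ∈ Finset.range (nilpotencyClass a), ((k.factorial : ℂ))⁻¹ • a ^ k


/-! Proof of the characterization of `∫ₑ`. -/

theorem ofVec_anti (a c : Cot n × W × Module.Dual ℂ W) :
    ExteriorAlgebra.ι ℂ a * ExteriorAlgebra.ι ℂ c = -(ExteriorAlgebra.ι ℂ c * ExteriorAlgebra.ι ℂ a) :=
  eq_neg_of_add_eq_zero_left (ExteriorAlgebra.ι_add_mul_swap a c)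

/-- The even element `eⱼ ∧ eⱼ*`. -/
def pairE (b : Module.Basis (Fin m) ℂ W) (j : Fin m) : Lam n W := ofVec (b j) * ofDual (b.coord j)

theorem pairE_comm (b : Module.Basis (Fin m) ℂ W) (j : Fin m) (x : Lam n W) :
    Commute (pairE b j) x := by
  induction x using ExteriorAlgebra.induction with
  | algebraMap r => exact (Algebra.commutes r _).symm
  | ι a =>
    change ofVec (b j) * ofDual (b.coord j) * ExteriorAlgebra.ι ℂ a
      = ExteriorAlgebra.ι ℂ a * (ofVec (b j) * ofDual (b.coord j))
    unfold ofVec ofDual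
    rw [mul_assoc, ofVec_anti _ a, mul_neg, ← mul_assoc, ofVec_anti _ a, neg_mul, neg_neg, mul_assoc]
  | mul x y hx hy => exact hx.mul_right hy
  | add x y hx hy => exact hx.add_right hy

theorem pairE_sq (b : Module.Basis (Fin m) ℂ W) (j : Fin m) :
    (pairE b j : Lam n W) * pairE b j = 0 := by
  have h := (pairE_comm b j (ofVec (b j) : Lam n W)).eq
  unfold pairE at h ⊢
  rw [← mul_assoc, h, ← mul_assoc]
  unfold ofVec
  rw [ExteriorAlgebra.ι_sq_zero]
  simp

theorem add_pow_of_sq_zero {A : Type*} [Ring A] (a t : A) (h : Commute a t) (h2 : a * a = 0)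
    (k : ℕ) : (a + t) ^ (k + 1) = t ^ (k + 1) + (k + 1) • (a * t ^ k) := by
  induction k with
  | zero => simp [add_comm]
  | succ k ih =>
    have e1 : a * (a * t ^ k) = 0 := by rw [← mul_assoc, h2, zero_mul]
    have e2 : t * (a * t ^ k) = a * t ^ (k + 1) := by
      rw [← mul_assoc, ← h.eq, mul_assoc, ← pow_succ']
    rw [pow_succ', ih, add_mul, mul_add, mul_add, mul_smul_comm, mul_smul_comm, e1, e2,
      smul_zero, add_zero, ← pow_succ', succ_nsmul _ (k + 1)]
    abel

theorem sum_pairE_pow (b : Module.Basis (Fin m) ℂ W) (l : List (Fin m)) :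
    ((l.map (pairE b)).sum : Lam n W) ^ l.length = l.length.factorial • (l.map (pairE b)).prod ∧
      ((l.map (pairE b)).sum : Lam n W) ^ (l.length + 1) = 0 := by
  induction l with
  | nil => simp
  | cons a l ih =>
    have h := add_pow_of_sq_zero (pairE b a : Lam n W) (l.map (pairE b)).sum (pairE_comm _ _ _)
      (pairE_sq b a)
    simp only [List.map_cons, List.sum_cons, List.length_cons, List.prod_cons]
    refine ⟨?_, ?_⟩
    · rw [h, ih.2, ih.1, zero_add, Nat.factorial_succ, mul_smul_comm, mul_nsmul']
    · rw [h, pow_succ, ih.2]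
      simp

theorem tildeEnd_one_eq (b : Module.Basis (Fin m) ℂ W) :
    (tildeEnd b 1 : Lam n W) = ((List.finRange m).map (pairE b)).sum := by
  rw [← List.ofFn_eq_map, List.sum_ofFn]
  unfold tildeEnd
  refine Finset.sum_congr rfl fun j _ => ?_
  rw [Finset.sum_eq_single j]
  · simp [pairE]
  · intro k _ hk
    simp [Matrix.one_apply_ne hk.symm]
  · simp

theorem tildeEnd_one_pow (b : Module.Basis (Fin m) ℂ W) :
    ((m.factorial : ℂ))⁻¹ • (tildeEnd b 1 : Lam n W) ^ m
      = ((List.finRange m).map (pairE b)).prod := by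
  have h := (sum_pairE_pow (n := n) b (List.finRange m)).1
  rw [List.length_finRange] at h
  rw [tildeEnd_one_eq, h, ← Nat.cast_smul_eq_nsmul ℂ, smul_smul, inv_mul_cancel₀, one_smul]
  exact_mod_cast m.factorial_ne_zero

/-- Contraction with a functional that only sees `E ⊕ E*`. -/
def ctr (φ : Module.Dual ℂ (W × Module.Dual ℂ W)) : Module.End ℂ (Lam n W) :=
  CliffordAlgebra.contractLeft (φ ∘ₗ LinearMap.snd ℂ (Cot n) (W × Module.Dual ℂ W))

theorem ctr_ι_mul (φ : Module.Dual ℂ (W × Module.Dual ℂ W)) (a : Cot n × W × Module.Dual ℂ W)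
    (x : Lam n W) : ctr φ (ExteriorAlgebra.ι ℂ a * x)
      = φ a.2 • x - ExteriorAlgebra.ι ℂ a * ctr φ x :=
  CliffordAlgebra.contractLeft_ι_mul _ _ _

theorem ctr_one (φ : Module.Dual ℂ (W × Module.Dual ℂ W)) : ctr φ (1 : Lam n W) = 0 :=
  CliffordAlgebra.contractLeft_one _ _

theorem ofForm_ι (a : Cot n) : (ofForm (ExteriorAlgebra.ι ℂ a) : Lam n W)
    = ExteriorAlgebra.ι ℂ (a, 0) := by
  unfold ofForm; rw [ExteriorAlgebra.map_apply_ι]; rfl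

/-- The sign involution of forms. -/
def invol : Form n →ₐ[ℂ] Form n := CliffordAlgebra.involute

theorem invol_ι (a : Cot n) : invol (ExteriorAlgebra.ι ℂ a) = -ExteriorAlgebra.ι ℂ a :=
  CliffordAlgebra.involute_ι _

theorem ctr_ofForm_mul (φ : Module.Dual ℂ (W × Module.Dual ℂ W)) (α : Form n) :
    ∀ x : Lam n W, ctr φ (ofForm α * x) = ofForm (invol α) * ctr φ x := by
  induction α using ExteriorAlgebra.induction with
  | algebraMap r =>
    intro x
    rw [AlgHom.commutes, AlgHom.commutes, AlgHom.commutes, ← Algebra.smul_def, map_smul, Algebra.smul_def]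
  | ι a =>
    intro x
    rw [invol_ι, map_neg, ofForm_ι, ctr_ι_mul]
    simp
  | mul x y hx hy => intro z; rw [map_mul ofForm, mul_assoc, hx, hy, map_mul, map_mul, mul_assoc]
  | add x y hx hy => intro z; rw [map_add, add_mul, map_add, hx, hy, map_add, map_add, add_mul]

theorem ctr_ofForm (φ : Module.Dual ℂ (W × Module.Dual ℂ W)) (α : Form n) :
    ctr φ (ofForm α : Lam n W) = 0 := by
  have h := ctr_ofForm_mul φ α (1 : Lam n W)
  rwa [ctr_one, mul_zero, mul_one] at h

theorem ι_mul_ofForm (u : W × Module.Dual ℂ W) (α : Form n) :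
    (ExteriorAlgebra.ι ℂ ((0 : Cot n), u) * ofForm α : Lam n W)
      = ofForm (invol α) * ExteriorAlgebra.ι ℂ ((0 : Cot n), u) := by
  induction α using ExteriorAlgebra.induction with
  | algebraMap r =>
    rw [AlgHom.commutes, AlgHom.commutes, AlgHom.commutes, Algebra.commutes]
  | ι a =>
    rw [invol_ι, map_neg, ofForm_ι, ofVec_anti, neg_mul]
  | mul x y hx hy => rw [map_mul, ← mul_assoc, hx, mul_assoc, hy, map_mul, map_mul, mul_assoc]
  | add x y hx hy => rw [map_add, mul_add, hx, hy, map_add, map_add, add_mul]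

theorem lowDeg_mono {c d : ℕ} (h : c ≤ d) : lowDeg n c W ≤ lowDeg n d W := by
  refine Submodule.span_mono ?_
  rintro w ⟨α, l, hl, rfl⟩
  exact ⟨α, l, hl.trans_le h, rfl⟩

theorem ofForm_mul_mem_lowDeg {d : ℕ} (α : Form n) {x : Lam n W} (hx : x ∈ lowDeg n d W) :
    ofForm α * x ∈ lowDeg n d W := by
  induction hx using Submodule.span_induction with
  | mem x h =>
    obtain ⟨β, l, hl, rfl⟩ := h
    exact Submodule.subset_span ⟨α * β, l, hl, by rw [map_mul, mul_assoc]⟩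
  | zero => simp
  | add x y _ _ hx hy => rw [mul_add]; exact add_mem hx hy
  | smul c x _ hx => rw [mul_smul_comm]; exact Submodule.smul_mem _ _ hx

theorem ι_mul_mem_lowDeg {d : ℕ} (u : W × Module.Dual ℂ W) {x : Lam n W}
    (hx : x ∈ lowDeg n d W) :
    ExteriorAlgebra.ι ℂ ((0 : Cot n), u) * x ∈ lowDeg n (d + 1) W := by
  induction hx using Submodule.span_induction with
  | mem x h =>
    obtain ⟨β, l, hl, rfl⟩ := h
    refine Submodule.subset_span ⟨invol β, u :: l, by simpa using hl, ?_⟩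
    rw [← mul_assoc, ι_mul_ofForm, mul_assoc, List.map_cons, List.prod_cons]
  | zero => simp
  | add x y _ _ hx hy => rw [mul_add]; exact add_mem hx hy
  | smul c x _ hx => rw [mul_smul_comm]; exact Submodule.smul_mem _ _ hx

theorem ctr_list_mem (φ : Module.Dual ℂ (W × Module.Dual ℂ W)) (l : List (W × Module.Dual ℂ W)) :
    ctr φ (l.map fun u => ExteriorAlgebra.ι ℂ ((0 : Cot n), u)).prod ∈ lowDeg n l.length W := by
  induction l with
  | nil =>
    rw [List.map_nil, List.prod_nil, ctr_one]
    exact zero_mem _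
  | cons u l ih =>
    rw [List.map_cons, List.prod_cons, ctr_ι_mul]
    refine sub_mem (Submodule.smul_mem _ _ ?_) (ι_mul_mem_lowDeg u ih)
    exact Submodule.subset_span ⟨1, l, by simp, by simp⟩

theorem ctr_mem_lowDeg {d : ℕ} (φ : Module.Dual ℂ (W × Module.Dual ℂ W)) {x : Lam n W}
    (hx : x ∈ lowDeg n (d + 1) W) : ctr φ x ∈ lowDeg n d W := by
  induction hx using Submodule.span_induction with
  | mem x h =>
    obtain ⟨β, l, hl, rfl⟩ := h
    rw [ctr_ofForm_mul]
    exact ofForm_mul_mem_lowDeg _ (lowDeg_mono (Nat.lt_succ_iff.mp hl) (ctr_list_mem φ l))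
  | zero => simp
  | add x y _ _ hx hy => rw [map_add]; exact add_mem hx hy
  | smul c x _ hx => rw [map_smul]; exact Submodule.smul_mem _ _ hx

theorem strip_eq (b : Module.Basis (Fin m) ℂ W) (j : Fin m) (x : Lam n W) :
    strip b j x = ctr (Module.Dual.eval ℂ W (b j) ∘ₗ LinearMap.snd ℂ W (Module.Dual ℂ W))
      (ctr (b.coord j ∘ₗ LinearMap.fst ℂ W (Module.Dual ℂ W)) x) := rfl

theorem strip_list_mem (b : Module.Basis (Fin m) ℂ W) (l : List (Fin m)) :
    ∀ x ∈ lowDeg n (2 * l.length) W,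
      (l.map fun j => (strip b j : Module.End ℂ (Lam n W))).prod x = 0 := by
  induction l using List.reverseRecOn with
  | nil =>
    intro x hx
    have h0 : lowDeg n 0 W = ⊥ := by
      rw [eq_bot_iff]
      refine Submodule.span_le.mpr ?_
      rintro w ⟨α, l, hl, rfl⟩
      exact absurd hl (Nat.not_lt_zero _)
    have hx' : x ∈ lowDeg n 0 W := hx
    rw [h0, Submodule.mem_bot] at hx'
    rw [hx', map_zero]
  | append_singleton l a ih =>
    intro x hx
    rw [List.map_append, List.prod_append, List.map_singleton, List.prod_singleton,
      Module.End.mul_apply]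
    refine ih _ ?_
    rw [strip_eq]
    refine ctr_mem_lowDeg _ (ctr_mem_lowDeg _ ?_)
    rw [List.length_append, List.length_singleton] at hx
    exact hx

theorem ctr_pairE_mul (φ : Module.Dual ℂ (W × Module.Dual ℂ W)) (b : Module.Basis (Fin m) ℂ W)
    (j : Fin m) (x : Lam n W) (hx : ctr φ x = 0) : ctr φ (pairE b j * x)
      = φ (b j, 0) • (ofDual (b.coord j) * x) - φ (0, b.coord j) • (ofVec (b j) * x) := by
  unfold pairE ofVec ofDual
  rw [mul_assoc, ctr_ι_mul, ctr_ι_mul, hx, mul_zero, sub_zero, mul_smul_comm]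

theorem ctr_list_pairE (φ : Module.Dual ℂ (W × Module.Dual ℂ W)) (b : Module.Basis (Fin m) ℂ W)
    (l : List (Fin m)) (α : Form n) (h : ∀ j ∈ l, φ (b j, 0) = 0 ∧ φ (0, b.coord j) = 0) :
    ctr φ ((l.map (pairE b)).prod * ofForm α : Lam n W) = 0 := by
  induction l with
  | nil => simpa using ctr_ofForm φ α
  | cons a l ih =>
    rw [List.map_cons, List.prod_cons, mul_assoc, ctr_pairE_mul _ _ _ _
      (ih fun j hj => h j (List.mem_cons_of_mem _ hj)), (h a List.mem_cons_self).1,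
      (h a List.mem_cons_self).2]
    simp

theorem strip_pairE_mul (b : Module.Basis (Fin m) ℂ W) (j : Fin m) (l : List (Fin m))
    (hj : j ∉ l) (α : Form n) :
    strip b j (pairE b j * ((l.map (pairE b)).prod * ofForm α) : Lam n W)
      = (l.map (pairE b)).prod * ofForm α := by
  have h1 : ctr (b.coord j ∘ₗ LinearMap.fst ℂ W (Module.Dual ℂ W))
      ((l.map (pairE b)).prod * ofForm α : Lam n W) = 0 := by
    refine ctr_list_pairE _ b l α fun k hk => ⟨?_, by simp⟩
    have : k ≠ j := fun h => hj (h ▸ hk)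
    simp [Finsupp.single_eq_of_ne this.symm]
  have h2 : ctr (Module.Dual.eval ℂ W (b j) ∘ₗ LinearMap.snd ℂ W (Module.Dual ℂ W))
      ((l.map (pairE b)).prod * ofForm α : Lam n W) = 0 := by
    refine ctr_list_pairE _ b l α fun k hk => ⟨by simp, ?_⟩
    have : k ≠ j := fun h => hj (h ▸ hk)
    simp [Finsupp.single_eq_of_ne this]
  rw [strip_eq, ctr_pairE_mul _ _ _ _ h1]
  have e1 : (b.coord j ∘ₗ LinearMap.fst ℂ W (Module.Dual ℂ W)) (b j, 0) = 1 := by simp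
  have e2 : (b.coord j ∘ₗ LinearMap.fst ℂ W (Module.Dual ℂ W)) (0, b.coord j) = 0 := by simp
  rw [e1, e2, one_smul, zero_smul, sub_zero]
  unfold ofDual
  rw [ctr_ι_mul, h2, mul_zero, sub_zero]
  simp

theorem strip_list_pairE (b : Module.Basis (Fin m) ℂ W) (l : List (Fin m)) (α : Form n) :
    l.Nodup → (l.map fun j => (strip b j : Module.End ℂ (Lam n W))).prod
      ((l.reverse.map (pairE b)).prod * ofForm α) = ofForm α := by
  induction l using List.reverseRecOn with
  | nil => simp
  | append_singleton l a ih =>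
    intro hl
    rw [List.nodup_append] at hl
    have ha : a ∉ l.reverse := by
      intro h
      exact hl.2.2 a (List.mem_reverse.mp h) a (by simp) rfl
    rw [List.map_append, List.prod_append, List.map_singleton, List.prod_singleton,
      Module.End.mul_apply, List.reverse_append, List.reverse_singleton, List.singleton_append,
      List.map_cons, List.prod_cons, mul_assoc, strip_pairE_mul b a l.reverse ha α]
    exact ih hl.1

/-- The defining property of the integral: `∫ₑ (ω' ∧ Ĩ^m / m! + ω'') = ω'`
if `ω''` has lower degree in `e, e*`. -/
theorem berezin_eq (b : Module.Basis (Fin m) ℂ W) (α : Form n) (β : Lam n W)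
    (hβ : β ∈ lowDeg n (2 * m) W) :
    berezin b (ofForm α * (((m.factorial : ℂ))⁻¹ • tildeEnd b 1 ^ m) + β) = α := by
  have hperm : ((List.finRange m).map (pairE b) : List (Lam n W)).prod
      = ((List.finRange m).reverse.map (pairE b)).prod := by
    refine List.Perm.prod_eq' ((List.reverse_perm _).symm.map _) ?_
    refine List.pairwise_map.mpr ?_
    exact List.pairwise_of_forall fun i j => pairE_comm _ _ _
  have hcomm : Commute (ofForm α : Lam n W) ((List.finRange m).reverse.map (pairE b)).prod := by
    refine Commute.list_prod_right _ _ ?_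
    intro y hy
    obtain ⟨j, -, rfl⟩ := List.mem_map.mp hy
    exact (pairE_comm _ _ _).symm
  have hlow : ((List.finRange m).map fun j => (strip b j : Module.End ℂ (Lam n W))).prod β = 0 := by
    refine strip_list_mem b _ β ?_
    rwa [List.length_finRange]
  rw [tildeEnd_one_pow, hperm, hcomm.eq]
  unfold berezin
  rw [LinearMap.comp_apply, List.ofFn_eq_map, map_add, hlow, add_zero,
    strip_list_pairE b _ α (List.nodup_finRange m)]
  unfold ofForm
  rw [AlgHom.toLinearMap_apply, ← AlgHom.comp_apply, ExteriorAlgebra.map_comp_map,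
    LinearMap.fst_comp_inl, ExteriorAlgebra.map_id, AlgHom.id_apply]

end Berezin
/-! ### Hermitian inner products, quotients, and the dual section of minimal norm -/

/-- A Hermitian inner product `⟨ξ, η⟩` on a complex vector space, linear in `ξ` and
conjugate-linear in `η`. -/
structure HermInner (W : Type*) [AddCommGroup W] [Module ℂ W] where
  form : W →ₗ[ℂ] W →ₗ⋆[ℂ] ℂ
  conj_symm : ∀ ξ η, (starRingEnd ℂ) (form ξ η) = form η ξ
  pos : ∀ ξ, ξ ≠ 0 → 0 < (form ξ ξ).re

namespace HermInner

variable {W : Type*} [AddCommGroup W] [Module ℂ W] (g : HermInner W) (v : W)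

theorem self_ne_zero {v : W} (hv : v ≠ 0) : g.form v v ≠ 0 := by
  intro h
  have := g.pos v hv
  rw [h] at this
  simp at this

/-- The orthogonal projection `ξ ↦ ξ - (⟨ξ, v⟩ / ⟨v, v⟩) v` onto the complement of `v`. -/
def proj : W →ₗ[ℂ] W :=
  LinearMap.id - ((g.form v v)⁻¹ • g.form.flip v).smulRight v

theorem proj_apply (ξ : W) : g.proj v ξ = ξ - ((g.form v v)⁻¹ * g.form ξ v) • v := rfl

theorem proj_self : g.proj v v = 0 := by
  by_cases hv : v = 0
  · subst hv; exact map_zero _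
  · rw [proj_apply, inv_mul_cancel₀ (g.self_ne_zero hv), one_smul, sub_self]

/-- The map `W / ℂv → W` sending a class to its representative orthogonal to `v`
(the adjoint of the natural projection). -/
def lift : (W ⧸ Submodule.span ℂ {v}) →ₗ[ℂ] W :=
  (Submodule.span ℂ {v}).liftQ (g.proj v) (by
    rw [Submodule.span_singleton_le_iff_mem, LinearMap.mem_ker, proj_self])

theorem lift_mk (ξ : W) : g.lift v (Submodule.Quotient.mk ξ) = g.proj v ξ := rfl

theorem mk_lift (a : W ⧸ Submodule.span ℂ {v}) :
    (Submodule.Quotient.mk (g.lift v a) : W ⧸ Submodule.span ℂ {v}) = a := by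
  obtain ⟨ξ, rfl⟩ := Submodule.Quotient.mk_surjective _ a
  rw [lift_mk, Submodule.Quotient.eq, proj_apply, sub_sub_cancel_left]
  exact neg_mem (Submodule.smul_mem _ _ (Submodule.mem_span_singleton_self v))

theorem lift_orthogonal (a : W ⧸ Submodule.span ℂ {v}) : g.form (g.lift v a) v = 0 := by
  obtain ⟨ξ, rfl⟩ := Submodule.Quotient.mk_surjective _ a
  by_cases hv : v = 0
  · rw [hv]; exact map_zero _
  · rw [lift_mk, proj_apply, map_sub, map_smul, LinearMap.sub_apply, LinearMap.smul_apply,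
      smul_eq_mul, mul_right_comm, inv_mul_cancel₀ (g.self_ne_zero hv), one_mul, sub_self]

/-- The inner product induced on the quotient `W / ℂv`. -/
def quot : HermInner (W ⧸ Submodule.span ℂ {v}) where
  form := (g.form.compl₂ (g.lift v)) ∘ₗ g.lift v
  conj_symm a c := g.conj_symm _ _
  pos a ha := by
    refine g.pos _ fun h => ha ?_
    rw [← g.mk_lift v a, h, Submodule.Quotient.mk_zero]

/-- The dual vector `σ = v* / |v|²`, where `v* · ξ = ⟨ξ, v⟩`. -/
def minDual : Module.Dual ℂ W := (g.form v v)⁻¹ • g.form.flip v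

theorem minDual_apply (ξ : W) : g.minDual v ξ = (g.form v v)⁻¹ * g.form ξ v := rfl

theorem minDual_self (hv : v ≠ 0) : g.minDual v v = 1 :=
  inv_mul_cancel₀ (g.self_ne_zero hv)

theorem form_self_im (ξ : W) : ((g.form ξ ξ).re : ℂ) = g.form ξ ξ :=
  Complex.conj_eq_iff_re.mp (g.conj_symm ξ ξ)

theorem form_self_nonneg (ξ : W) : 0 ≤ (g.form ξ ξ).re := by
  by_cases h : ξ = 0
  · subst h; simp
  · exact (g.pos ξ h).le

theorem norm_minDual_le (hv : v ≠ 0) (ξ : W) :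
    ‖g.minDual v ξ‖ ^ 2 * (g.form v v).re ≤ (g.form ξ ξ).re := by
  have hne := g.self_ne_zero hv
  set c := g.minDual v ξ with hc
  have hcξ : g.form ξ v = c * g.form v v := by
    rw [hc, minDual_apply]; field_simp
  have hvξ : g.form v ξ = (starRingEnd ℂ) c * g.form v v := by
    rw [← g.conj_symm, hcξ, map_mul, g.conj_symm]
  have h0 := g.form_self_nonneg (ξ - c • v)
  have h1 : g.form (ξ - c • v) (ξ - c • v) = g.form ξ ξ - c * (starRingEnd ℂ) c * g.form v v := by
    simp only [map_sub, map_smul, LinearMap.sub_apply, LinearMap.smul_apply, smul_eq_mul,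
      map_smulₛₗ, hcξ, hvξ]
    ring
  rw [h1, Complex.mul_conj, ← g.form_self_im v, ← Complex.ofReal_mul, Complex.sub_re,
    Complex.ofReal_re, Complex.normSq_eq_norm_sq] at h0
  linarith

/-- `σ = v* / |v|²` has minimal norm among the dual vectors `τ` with `τ · v = 1`: every bound
`|τ · ξ|² ≤ C |ξ|²` holds for `σ` as well. -/
theorem minDual_minimal (hv : v ≠ 0) (τ : Module.Dual ℂ W) (hτ : τ v = 1) (C : ℝ)
    (hC : ∀ ξ, ‖τ ξ‖ ^ 2 ≤ C * (g.form ξ ξ).re) (ξ : W) :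
    ‖g.minDual v ξ‖ ^ 2 ≤ C * (g.form ξ ξ).re := by
  have h1 := hC v
  rw [hτ, norm_one, one_pow] at h1
  have h2 := g.norm_minDual_le v hv ξ
  have h3 := g.pos v hv
  have hC0 : 0 < C := by
    by_contra h
    nlinarith
  nlinarith [sq_nonneg ‖g.minDual v ξ‖, mul_le_mul_of_nonneg_left h2 hC0.le,
    mul_le_mul_of_nonneg_left h1 (sq_nonneg ‖g.minDual v ξ‖)]

end HermInner

/-! ### Bundles over a complex manifold -/

section Bundles

variable {n m r : ℕ} {X : Type*} [TopologicalSpace X] [ChartedSpace (Coord n) X]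

/-- The model fibre `ℂᵐ`. -/
abbrev Fib (m : ℕ) : Type := EuclideanSpace ℂ (Fin m)

/-- The Gram matrix `Hⱼₖ = ⟨eⱼ, eₖ⟩` of a frame, in the coordinates given by the chart `ψ`. -/
def localGram {G : X → Type*} [∀ x, AddCommGroup (G x)] [∀ x, Module ℂ (G x)]
    (g : ∀ x, HermInner (G x)) (e : Fin r → ∀ x, G x) (ψ : OpenPartialHomeomorph X (Coord n))
    (p : Coord n) : Matrix (Fin r) (Fin r) ℂ :=
  Matrix.of fun j k => (g (ψ.symm p)).form (e j (ψ.symm p)) (e k (ψ.symm p))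

variable {E : X → Type*} [TopologicalSpace (Bundle.TotalSpace (Fib m) E)]
  [∀ x, AddCommGroup (E x)] [∀ x, Module ℂ (E x)] [∀ x, TopologicalSpace (E x)]
  [FiberBundle (Fib m) E]

/-- The section `s` of the holomorphic vector bundle `E` is holomorphic on `U`. -/
def HolOn (n m : ℕ) {X : Type*} [TopologicalSpace X] [ChartedSpace (Coord n) X] {E : X → Type*}
    [TopologicalSpace (Bundle.TotalSpace (Fib m) E)] [∀ x, TopologicalSpace (E x)]
    [FiberBundle (Fib m) E] (s : ∀ x, E x) (U : Set X) : Prop :=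
  ContMDiffOn 𝓘(ℂ, Coord n) (𝓘(ℂ, Coord n).prod 𝓘(ℂ, Fib m)) ω
    (fun x => Bundle.TotalSpace.mk' (Fib m) x (s x)) U

/-- A (smooth) Hermitian metric on the holomorphic vector bundle `E`. -/
structure HermitianMetric (n m : ℕ) {X : Type*} [TopologicalSpace X] [ChartedSpace (Coord n) X]
    (E : X → Type*) [TopologicalSpace (Bundle.TotalSpace (Fib m) E)]
    [∀ x, AddCommGroup (E x)] [∀ x, Module ℂ (E x)] [∀ x, TopologicalSpace (E x)]
    [FiberBundle (Fib m) E] where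
  inner : ∀ x, HermInner (E x)
  smooth : ∀ (U : Set X), IsOpen U → ∀ s t : ∀ x, E x, HolOn n m s U → HolOn n m t U →
    ContMDiffOn 𝓘(ℝ, Coord n) 𝓘(ℝ, ℂ) ∞ (fun x => (inner x).form (s x) (t x)) U

/-- The fibre of `Q = E / S`, where `S` is spanned by `f`. -/
abbrev QuotFib (f : ∀ x, E x) (x : X) : Type _ := E x ⧸ Submodule.span ℂ {f x}

/-- The metric of `Q = E / S` induced by the metric of `E`. -/
def quotMetric (h : HermitianMetric n m E) (f : ∀ x, E x) (x : X) : HermInner (QuotFib f x) :=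
  (h.inner x).quot (f x)

/-- `q₁, …, q_r` is a holomorphic frame of `Q = E / S` over `U`: the values form a basis of each
fibre, and each `qⱼ` is locally the image of a holomorphic section of `E`. -/
structure IsQuotFrame (f : ∀ x, E x) (q : Fin r → ∀ x, QuotFib f x) (U : Set X) : Prop where
  linearIndependent : ∀ x ∈ U, LinearIndependent ℂ fun j => q j x
  generating : ∀ x ∈ U, ⊤ ≤ Submodule.span ℂ (Set.range fun j => q j x)
  holomorphic : ∀ j, ∀ x ∈ U, ∃ V : Set X, IsOpen V ∧ x ∈ V ∧ ∃ s : ∀ y, E y,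
    HolOn n m s V ∧ ∀ y ∈ V, q j y = Submodule.Quotient.mk (s y)

/-- `e₁, …, e_m` is a holomorphic frame of `E` over `U`. -/
abbrev IsFrame (e : Fin m → ∀ x, E x) (U : Set X) : Prop :=
  IsLocalFrameOn 𝓘(ℂ, Coord n) (Fib m) ω e U

/-- The Chern form `c(D_Q)` of the quotient bundle `Q = E / S` at the point `x`, in the
holomorphic frame `q` of `Q` and in the coordinates `ψ`. -/
def chernFormQ (h : HermitianMetric n m E) (f : ∀ x, E x) (q : Fin r → ∀ x, QuotFib f x)
    (ψ : OpenPartialHomeomorph X (Coord n)) (x : X) : Form n :=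
  chernForm (localGram (quotMetric h f) q ψ) (ψ x)

variable {e : Fin m → ∀ x, E x} {U : Set X} {x : X}

/-- The element `Ĩ` of `Λ` at `x`. -/
def tildeI (he : IsFrame (n := n) e U) (hx : x ∈ U) : Lam n (E x) :=
  tildeEnd (he.toBasisAt hx) 1

/-- The element `Θ̃` of `Λ` at `x`, where `Θ` is the curvature of the Chern connection of `E`. -/
def tildeTheta (h : HermitianMetric n m E) (he : IsFrame (n := n) e U)
    (ψ : OpenPartialHomeomorph X (Coord n)) (hx : x ∈ U) : Lam n (E x) :=
  tildeEnd (he.toBasisAt hx) (chernCurvature (localGram h.inner e ψ) (ψ x))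

/-- `Df = ∑ⱼ (dfⱼ + ∑ₖ θⱼₖ fₖ) ∧ eⱼ` as an element of `Λ` at `x`, where `f = ∑ fⱼ eⱼ` and `θ` is
the matrix of the Chern connection `D` of `E`. -/
def tildeD (h : HermitianMetric n m E) (he : IsFrame (n := n) e U)
    (ψ : OpenPartialHomeomorph X (Coord n)) (hx : x ∈ U) (f : ∀ x, E x) : Lam n (E x) :=
  tildeVec (he.toBasisAt hx) fun j =>
    fderiv ℝ (fun p => he.coeff j (ψ.symm p) (f (ψ.symm p))) (ψ x)
      + ∑ k, he.coeff k x (f x) • chernConnection (localGram h.inner e ψ) (ψ x) j k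

/-- The section `σ = f* / |f|²` of the dual bundle `E*`. -/
def sigma (h : HermitianMetric n m E) (f : ∀ x, E x) (x : X) : Module.Dual ℂ (E x) :=
  (h.inner x).minDual (f x)

/-- `∂̄τ = ∑ₖ ∂̄τₖ ∧ eₖ*` as an element of `Λ` at `x`, for a section `τ = ∑ₖ τₖ eₖ*` of `E*`,
where `τₖ = τ · eₖ` (the dual frame `eₖ*` is holomorphic). -/
def tildeDelbar (he : IsFrame (n := n) e U) (ψ : OpenPartialHomeomorph X (Coord n)) (hx : x ∈ U)
    (τ : ∀ x, Module.Dual ℂ (E x)) : Lam n (E x) :=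
  tildeDual (he.toBasisAt hx) fun k =>
    delbar (fun p => τ (ψ.symm p) (e k (ψ.symm p))) (ψ x)

/-- The integral `∫ₑ` at `x`. -/
def intE (he : IsFrame (n := n) e U) (hx : x ∈ U) : Lam n (E x) →ₗ[ℂ] Form n :=
  berezin (he.toBasisAt hx)

end Bundles

end
end ChernQuotient

namespace ChernQuotient

noncomputable section

/-! ### Commutative algebra of square-zero elements -/

/-! The proof combines an algebraic identity in one fibre with a computation of the curvature of the
quotient.

Algebra: complete `f` to a basis `f, w₁, …, w_r` of the fibre with all `w_l` orthogonal to `f`; the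
dual vector of `f` in this basis is then `σ`. Multiplication by `f ∧ σ` kills every term containing
`f` or `σ`. Hence, for an endomorphism `M` with even form entries, `f ∧ σ ∧ exp(M̃)` only sees the
matrix `A` defined by `M w_l = ∑ A_il w_i` modulo `f`. What remains of `M̃` is a sum of `r`
commuting square-zero elements. Its `r`-th power over `r!` is `det A · ∏ w_l ∧ w_l*`, its higher
powers vanish, and its lower powers have too low a degree for `∫ₑ`. Since `f ∧ σ ∧ ∏ w_l ∧ w_l* =
Ĩ^m / m!`, the integral is `det A`. This is `berezin_expNil_eq_detForm`, with `prod_sum_mul_eq_det`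
producing the determinant.

Geometry: lift a holomorphic frame of `Q` to holomorphic sections `s_l` of `E` and put `w_l = s_l -
(σ · s_l) f`. The `(1,0)`-part of `D w_l` is given by the Chern connection of `Q`, and the
`(0,1)`-part is `-f ⊗ (∂̄σ · s_l)` (`quot_connection`). Applying `D` once more, and using `∂̄σ · f =
∂̄(σ · f) = 0`, shows that `Θ + Df ∧ ∂̄σ`, with the form factors multiplied as matrices, induces
`Θ_Q` modulo `f` (`quot_curvature`). In `Λ`, moving `∂̄σ_k` past `e_j` reverses the sign of `Df ∧
∂̄σ`, which accounts for the minus sign in the formula. The algebraic identity applied to `M = I +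
ℵ(Θ + Df ∧ ∂̄σ)` and `A = I_Q + ℵ Θ_Q` finishes the proof. -/

theorem sum_pow_of_sq_zero {R ι : Type*} [CommRing R] (y : ι → R) (hy : ∀ i, y i * y i = 0)
    (s : Finset ι) :
    (∑ i ∈ s, y i) ^ s.card = (s.card.factorial : R) * ∏ i ∈ s, y i ∧
      (∑ i ∈ s, y i) ^ (s.card + 1) = 0 := by
  classical
  induction s using Finset.induction_on with
  | empty => simp
  | insert a s ha ih =>
    -- The binomial expansion stops after the term linear in `y a`.
    have h := add_pow_of_sq_zero (y a) (∑ i ∈ s, y i) (Commute.all _ _) (hy a)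
    rw [Finset.sum_insert ha, Finset.card_insert_of_notMem ha, Finset.prod_insert ha]
    refine ⟨?_, ?_⟩
    · rw [h, ih.2, ih.1, Nat.factorial_succ, nsmul_eq_mul]
      push_cast
      ring
    · rw [h, pow_succ, ih.2]
      simp

/-- The left side is multilinear in the columns of `A`, and the sign rule for exchanging first
indices makes it alternating. It is therefore a multiple of the determinant, and the identity matrix
gives the factor. The intended case is `z l k = w_l ∧ w_k*`. -/
theorem prod_sum_mul_eq_det {R : Type*} [CommRing R] {r : ℕ} (z : Fin r → Fin r → R)
    (h0 : ∀ l i j, z l i * z l j = 0) (h1 : ∀ l l' i j, z l i * z l' j = -(z l' i * z l j))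
    (A : Matrix (Fin r) (Fin r) R) :
    ∏ k, ∑ l, A l k * z l k = A.det * ∏ k, z k k := by
  let D : (Fin r → R) [⋀^Fin r]→ₗ[R] R :=
    { toFun := fun v => ∏ k, ∑ l, v k l * z l k
      map_update_add' := by
        intro _ v i x y
        have hd : ∀ u : Fin r → R, ∏ k, ∑ l, Function.update v i u k l * z l k
            = (∑ l, u l * z l i) * ∏ k ∈ Finset.univ.erase i, ∑ l, v k l * z l k := by
          intro u
          rw [← Finset.mul_prod_erase _ _ (Finset.mem_univ i), Function.update_self]
          congr 1
          refine Finset.prod_congr rfl fun k hk => ?_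
          rw [Function.update_of_ne (Finset.ne_of_mem_erase hk)]
        convert_to ∏ k, ∑ l, Function.update v i (x + y) k l * z l k
          = ∏ k, ∑ l, Function.update v i x k l * z l k
            + ∏ k, ∑ l, Function.update v i y k l * z l k
        rw [hd, hd, hd, ← add_mul]
        simp only [Pi.add_apply, add_mul, Finset.sum_add_distrib]
      map_update_smul' := by
        intro _ v i c x
        have hd : ∀ u : Fin r → R, ∏ k, ∑ l, Function.update v i u k l * z l k
            = (∑ l, u l * z l i) * ∏ k ∈ Finset.univ.erase i, ∑ l, v k l * z l k := by
          intro u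
          rw [← Finset.mul_prod_erase _ _ (Finset.mem_univ i), Function.update_self]
          congr 1
          refine Finset.prod_congr rfl fun k hk => ?_
          rw [Function.update_of_ne (Finset.ne_of_mem_erase hk)]
        convert_to ∏ k, ∑ l, Function.update v i (c • x) k l * z l k
          = c • ∏ k, ∑ l, Function.update v i x k l * z l k
        rw [hd, hd, smul_eq_mul, ← mul_assoc, Finset.mul_sum]
        simp only [Pi.smul_apply, smul_eq_mul, mul_assoc]
      map_eq_zero_of_eq' := by
        intro v i j hv hij
        rw [← Finset.mul_prod_erase _ _ (Finset.mem_univ i),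
          ← Finset.mul_prod_erase _ _ (Finset.mem_erase.mpr ⟨hij.symm, Finset.mem_univ j⟩),
          ← mul_assoc, hv]
        convert zero_mul _
        have hanti : (∑ l, v j l * z l i) * (∑ l, v j l * z l j)
            = ∑ l, ∑ l', v j l * v j l' * (z l i * z l' j) := by
          rw [Finset.sum_mul_sum]
          refine Finset.sum_congr rfl fun l _ => Finset.sum_congr rfl fun l' _ => by ring
        rw [hanti, ← Finset.sum_product']
        -- With two equal columns the coefficients are symmetric in `l, l'` while the products of
        -- the `z` are antisymmetric, so the terms cancel in pairs; the diagonal terms vanish by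
        -- `h0`.
        refine Finset.sum_involution (fun p _ => (p.2, p.1)) ?_ ?_ ?_ ?_
        · rintro ⟨l, l'⟩ _
          simp only
          rw [h1 l l']
          ring
        · rintro ⟨l, l'⟩ _ hne heq
          simp only [Prod.mk.injEq] at heq
          refine hne ?_
          simp only
          rw [heq.1, h0, mul_zero]
        · intro p _
          exact Finset.mem_univ _
        · intro p _
          rfl }
  have hext : D = (LinearMap.toSpanSingleton R R (∏ k, z k k)).compAlternatingMap
      Matrix.detRowAlternating := by
    refine (Pi.basisFun R (Fin r)).ext_alternating fun v hv => ?_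
    -- An injective choice of basis vectors is a permutation, and both alternating maps pick up its
    -- sign, so only the standard basis in its own order has to be compared.
    obtain ⟨τ, hτ⟩ : ∃ τ : Equiv.Perm (Fin r), ⇑τ = v :=
      ⟨Equiv.ofBijective v (Finite.injective_iff_bijective.mp hv), rfl⟩
    have hcomp : (fun i => Pi.basisFun R (Fin r) (v i)) = (⇑(Pi.basisFun R (Fin r))) ∘ τ := by
      funext i
      rw [Function.comp_apply, hτ]
    rw [hcomp, AlternatingMap.map_perm, AlternatingMap.map_perm]
    congr 1
    have hdet : Matrix.detRowAlternating (⇑(Pi.basisFun R (Fin r))) = (1 : R) := by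
      change Matrix.det (Matrix.of ⇑(Pi.basisFun R (Fin r))) = 1
      rw [← Matrix.det_one (n := Fin r)]
      congr 1
      ext i j
      simp [Matrix.one_apply, Pi.single_apply, eq_comm]
    rw [LinearMap.compAlternatingMap_apply, hdet, LinearMap.toSpanSingleton_apply, one_smul]
    change ∏ k, ∑ l, Pi.basisFun R (Fin r) k l * z l k = _
    refine Finset.prod_congr rfl fun k _ => ?_
    rw [Finset.sum_eq_single k]
    · simp
    · intro l _ hl
      simp [hl]
    · simp
  have h := congrArg (fun φ : (Fin r → R) [⋀^Fin r]→ₗ[R] R => φ fun k l => A l k) hext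
  change ∏ k, ∑ l, A l k * z l k = (LinearMap.toSpanSingleton R R (∏ k, z k k))
    (Matrix.det A.transpose) at h
  rw [h, Matrix.det_transpose, LinearMap.toSpanSingleton_apply, smul_eq_mul]

/-- All powers from the nilpotency class on vanish, so the exponential may be truncated at any
exponent known to kill `a`. -/
theorem expNil_eq_sum {A : Type*} [Ring A] [Algebra ℂ A] (a : A) (N : ℕ) (h : a ^ N = 0) :
    expNil a = ∑ k ∈ Finset.range N, ((k.factorial : ℂ))⁻¹ • a ^ k := by
  have hle : nilpotencyClass a ≤ N := Nat.sInf_le h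
  refine Finset.sum_subset (Finset.range_mono hle) fun k _ hk => ?_
  rw [pow_eq_zero_of_le (by simpa using hk) (pow_nilpotencyClass ⟨N, h⟩), smul_zero]

/-- If a central element does not distinguish `a` from `c`, it does not distinguish their powers. -/
theorem central_mul_pow {A : Type*} [Ring A] {p a c : A} (hp : ∀ x, Commute p x)
    (h : p * a = p * c) (k : ℕ) : p * a ^ k = p * c ^ k := by
  induction k with
  | zero => simp
  | succ k ih =>
    rw [pow_succ, ← mul_assoc, (hp (a ^ k)).eq, mul_assoc, h, ← mul_assoc, ← (hp (a ^ k)).eq, ih,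
      mul_assoc, ← pow_succ]

/-! ### The integral of `f ∧ σ ∧ exp` as a determinant -/

section BerezinDet

variable {n m : ℕ} {W : Type*} [AddCommGroup W] [Module ℂ W]

/-- Passing a pair of vectors costs two signs. All the even elements that occur below therefore lie
in the centre of `Λ`, a commutative ring in which determinants and the binomial formula are
available. -/
theorem ι_mul_ι_commute (u v : Cot n × W × Module.Dual ℂ W) (x : Lam n W) :
    Commute (ExteriorAlgebra.ι ℂ u * ExteriorAlgebra.ι ℂ v) x := by
  induction x using ExteriorAlgebra.induction with
  | algebraMap r => exact (Algebra.commutes r _).symm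
  | ι a =>
    change _ * _ = _ * _
    rw [mul_assoc, ofVec_anti _ a, mul_neg, ← mul_assoc, ofVec_anti _ a, neg_mul, neg_neg, mul_assoc]
  | mul x y hx hy => exact hx.mul_right hy
  | add x y hx hy => exact hx.add_right hy

theorem mem_center_iff {A : Type*} [Ring A] [Algebra ℂ A] {z : A} :
    z ∈ Subalgebra.center ℂ A ↔ ∀ x, Commute z x := by
  rw [Subalgebra.mem_center_iff]
  exact forall_congr' fun x => eq_comm

theorem ι_mul_ι_mem_center (u v : Cot n × W × Module.Dual ℂ W) :
    ExteriorAlgebra.ι ℂ u * ExteriorAlgebra.ι ℂ v ∈ Subalgebra.center ℂ (Lam n W) :=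
  mem_center_iff.mpr (ι_mul_ι_commute u v)

theorem ofForm_oneForm_mul_mem_center (a c : Cot n) :
    (ofForm (oneForm a * oneForm c) : Lam n W) ∈ Subalgebra.center ℂ (Lam n W) := by
  unfold oneForm
  rw [map_mul, ofForm_ι, ofForm_ι]
  exact ι_mul_ι_mem_center _ _

theorem ofVec_mul_ofDual_mem_center (v : W) (η : Module.Dual ℂ W) :
    ofVec v * ofDual η ∈ Subalgebra.center ℂ (Lam n W) :=
  ι_mul_ι_mem_center _ _

theorem ofVec_sum_smul {ι : Type*} (s : Finset ι) (c : ι → ℂ) (v : ι → W) :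
    (ofVec (∑ i ∈ s, c i • v i) : Lam n W) = ∑ i ∈ s, c i • ofVec (v i) := by
  have h : ∀ v : W, (ofVec v : Lam n W) = (ExteriorAlgebra.ι ℂ ∘ₗ
    LinearMap.inr ℂ (Cot n) (W × Module.Dual ℂ W) ∘ₗ LinearMap.inl ℂ W (Module.Dual ℂ W)) v :=
    fun _ => rfl
  simp only [h, map_sum, map_smul]

theorem ofDual_sum_smul {ι : Type*} (s : Finset ι) (c : ι → ℂ) (v : ι → Module.Dual ℂ W) :
    (ofDual (∑ i ∈ s, c i • v i) : Lam n W) = ∑ i ∈ s, c i • ofDual (v i) := by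
  have h : ∀ v : Module.Dual ℂ W, (ofDual v : Lam n W) = (ExteriorAlgebra.ι ℂ ∘ₗ
    LinearMap.inr ℂ (Cot n) (W × Module.Dual ℂ W) ∘ₗ LinearMap.inr ℂ W (Module.Dual ℂ W)) v :=
    fun _ => rfl
  simp only [h, map_sum, map_smul]

theorem ofVec_mul_ofVec_self (v : W) : (ofVec v : Lam n W) * ofVec v = 0 :=
  ExteriorAlgebra.ι_sq_zero _

theorem ofDual_mul_ofDual_self (v : Module.Dual ℂ W) : (ofDual v : Lam n W) * ofDual v = 0 :=
  ExteriorAlgebra.ι_sq_zero _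

/-- Rewriting `ã` with the dual of another basis in the second factor. -/
theorem tildeEnd_eq_sum_basis {k : ℕ} (b : Module.Basis (Fin m) ℂ W)
    (b' : Module.Basis (Fin k) ℂ W) (M : Matrix (Fin m) (Fin m) (Form n)) :
    (tildeEnd b M : Lam n W) = ∑ l, (∑ j, ofForm (∑ i, b.coord i (b' l) • M j i) * ofVec (b j))
      * ofDual (b'.coord l) := by
  have hc : ∀ i, (ofDual (b.coord i) : Lam n W)
      = ∑ l, b.coord i (b' l) • ofDual (b'.coord l) := by
    intro i
    rw [← ofDual_sum_smul]
    congr 1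
    refine b'.ext fun l => ?_
    rw [LinearMap.sum_apply, Finset.sum_eq_single l]
    · simp
    · intro l' _ hl
      simp [Finsupp.single_eq_of_ne hl]
    · simp
  unfold tildeEnd
  simp only [hc, map_sum, map_smul, Finset.sum_mul, Finset.mul_sum, smul_mul_assoc,
    mul_smul_comm]
  rw [Finset.sum_congr rfl fun j _ => Finset.sum_comm, Finset.sum_comm]

/-- In both cases the first factors recombine to the vectors of `b'`, giving `∑ b'_l ∧ b'_l*`. This
lets `∫ₑ`, defined by the given frame, be evaluated in the basis adapted to `f`. -/
theorem tildeEnd_one_basis {k : ℕ} (b : Module.Basis (Fin m) ℂ W)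
    (b' : Module.Basis (Fin k) ℂ W) : (tildeEnd b 1 : Lam n W) = tildeEnd b' 1 := by
  rw [tildeEnd_eq_sum_basis b b', tildeEnd_eq_sum_basis b' b']
  have key : ∀ {d : ℕ} (c : Module.Basis (Fin d) ℂ W) (v : W),
      ∑ j, ofForm (∑ i, c.coord i v • (1 : Matrix (Fin d) (Fin d) (Form n)) j i) * ofVec (c j)
        = (ofVec v : Lam n W) := by
    intro d c v
    conv_rhs => rw [← c.sum_repr v, ofVec_sum_smul]
    refine Finset.sum_congr rfl fun j _ => ?_
    rw [Finset.sum_eq_single j]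
    · simp
    · intro i _ hi
      rw [Matrix.one_apply_ne hi.symm, smul_zero]
    · simp
  simp only [key]

theorem tildeEnd_mul_mem_lowDeg (b : Module.Basis (Fin m) ℂ W)
    (M : Matrix (Fin m) (Fin m) (Form n)) {d : ℕ} {x : Lam n W} (hx : x ∈ lowDeg n d W) :
    tildeEnd b M * x ∈ lowDeg n (d + 2) W := by
  unfold tildeEnd
  simp only [Finset.sum_mul, mul_assoc]
  exact sum_mem fun j _ => sum_mem fun k _ => ofForm_mul_mem_lowDeg _
    (ι_mul_mem_lowDeg (b j, 0) (ι_mul_mem_lowDeg (0, b.coord k) hx))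

/-- The index of `lowDeg` is a strict bound, so `2 * k + 1` stands for degree at most `2k`. -/
theorem tildeEnd_pow_mem_lowDeg (b : Module.Basis (Fin m) ℂ W)
    (M : Matrix (Fin m) (Fin m) (Form n)) (k : ℕ) :
    (tildeEnd b M : Lam n W) ^ k ∈ lowDeg n (2 * k + 1) W := by
  induction k with
  | zero => exact Submodule.subset_span ⟨1, [], by simp, by simp⟩
  | succ k ih =>
    rw [pow_succ']
    exact tildeEnd_mul_mem_lowDeg b M ih

theorem smul_mem_center {A : Type*} [Ring A] [Algebra ℂ A] (c : ℂ) {z : A}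
    (hz : z ∈ Subalgebra.center ℂ A) : c • z ∈ Subalgebra.center ℂ A :=
  Subalgebra.smul_mem _ hz c

/-- Grouped by the factor `e_k*`, the element is a sum of `m` central elements, each of square zero
because `e_k*` would occur twice. -/
theorem tildeEnd_pow_eq_zero (b : Module.Basis (Fin m) ℂ W)
    (M : Matrix (Fin m) (Fin m) (Form n))
    (hM : ∀ j k, (ofForm (M j k) : Lam n W) ∈ Subalgebra.center ℂ (Lam n W)) :
    (tildeEnd b M : Lam n W) ^ (m + 1) = 0 := by
  set g : Fin m → Lam n W := fun k => ∑ j, ofForm (M j k) * ofVec (b j)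
  have hmem : ∀ k, g k * ofDual (b.coord k) ∈ Subalgebra.center ℂ (Lam n W) := by
    intro k
    rw [Finset.sum_mul]
    refine sum_mem fun j _ => ?_
    rw [mul_assoc]
    exact mul_mem (hM j k) (ofVec_mul_ofDual_mem_center _ _)
  let y : Fin m → Subalgebra.center ℂ (Lam n W) := fun k => ⟨_, hmem k⟩
  have hy : ∀ k, y k * y k = 0 := by
    intro k
    apply Subtype.ext
    change g k * ofDual (b.coord k) * (g k * ofDual (b.coord k)) = 0
    rw [← mul_assoc, (mem_center_iff.mp (hmem k) (g k)).eq, mul_assoc, mul_assoc,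
      ofDual_mul_ofDual_self, mul_zero, mul_zero]
  have hT : tildeEnd b M = ((∑ k, y k : Subalgebra.center ℂ (Lam n W)) : Lam n W) := by
    rw [AddSubmonoidClass.coe_finsetSum]
    unfold tildeEnd
    rw [Finset.sum_comm]
    exact Finset.sum_congr rfl fun k _ => (Finset.sum_mul _ _ _).symm
  have h := (sum_pow_of_sq_zero y hy Finset.univ).2
  rw [Finset.card_univ, Fintype.card_fin] at h
  rw [hT, ← SubmonoidClass.coe_pow, h]
  rfl

/-- The ordered Leibniz products are formed in a noncommutative algebra. Once the entries are
central their order does not matter, and the sum is a genuine determinant over the centre. -/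
theorem ofForm_detForm {r : ℕ} (A : Matrix (Fin r) (Fin r) (Form n))
    (B : Matrix (Fin r) (Fin r) (Subalgebra.center ℂ (Lam n W)))
    (h : ∀ i j, (B i j : Lam n W) = ofForm (A i j)) :
    (ofForm (detForm A) : Lam n W) = (B.det : Lam n W) := by
  change _ = (Subalgebra.center ℂ (Lam n W)).val B.det
  unfold detForm
  rw [Matrix.det_apply', map_sum, map_sum]
  refine Finset.sum_congr rfl fun τ _ => ?_
  have hprod : (ofForm (List.ofFn fun i => A (τ i) i).prod : Lam n W)
      = (Subalgebra.center ℂ (Lam n W)).val (∏ i, B (τ i) i) := by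
    rw [← List.prod_ofFn, map_list_prod, map_list_prod, List.map_ofFn, List.map_ofFn]
    congr 2
    funext i
    exact (h _ _).symm
  rw [map_zsmul ofForm, hprod, map_mul, map_intCast]
  exact zsmul_eq_mul _ _

/-- If the endomorphism `M` induces the endomorphism with matrix `A` on the quotient by the first
vector of the basis `b'`, then `∫ₑ b'₀ ∧ b'₀* ∧ exp(M̃) = det A`. -/
theorem berezin_expNil_eq_detForm {r : ℕ} (b : Module.Basis (Fin m) ℂ W)
    (b' : Module.Basis (Fin (r + 1)) ℂ W) (M : Matrix (Fin m) (Fin m) (Form n))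
    (A : Matrix (Fin r) (Fin r) (Form n)) (c : Fin r → Form n)
    (hM : ∀ j k, (ofForm (M j k) : Lam n W) ∈ Subalgebra.center ℂ (Lam n W))
    (hA : ∀ j k, (ofForm (A j k) : Lam n W) ∈ Subalgebra.center ℂ (Lam n W))
    (hMA : ∀ l : Fin r,
      (∑ j, ofForm (∑ i, b.coord i (b' l.succ) • M j i) * ofVec (b j) : Lam n W)
        = ∑ i : Fin r, ofForm (A i l) * ofVec (b' i.succ) + ofForm (c l) * ofVec (b' 0)) :
    berezin b (ofVec (b' 0) * ofDual (b'.coord 0) * expNil (tildeEnd b M)) = detForm A := by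
  obtain rfl : m = r + 1 := by
    simpa using Fintype.card_congr (b.indexEquiv b')
  set pf : Lam n W := ofVec (b' 0) * ofDual (b'.coord 0) with hpf
  have hpfc : ∀ x, Commute pf x := mem_center_iff.mp (ofVec_mul_ofDual_mem_center _ _)
  have hzmem : ∀ i l : Fin r, (ofVec (b' i.succ) * ofDual (b'.coord l.succ) : Lam n W)
      ∈ Subalgebra.center ℂ (Lam n W) := fun i l => ofVec_mul_ofDual_mem_center _ _
  let z : Fin r → Fin r → Subalgebra.center ℂ (Lam n W) := fun i l => ⟨_, hzmem i l⟩
  let B : Matrix (Fin r) (Fin r) (Subalgebra.center ℂ (Lam n W)) := fun i l => ⟨_, hA i l⟩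
  let y : Fin r → Subalgebra.center ℂ (Lam n W) := fun l => ∑ i, B i l * z i l
  have hz1 : ∀ i i' l l', z i l * z i' l' = -(z i' l * z i l') := by
    intro i i' l l'
    apply Subtype.ext
    change ofVec (b' i.succ) * ofDual (b'.coord l.succ) *
        (ofVec (b' i'.succ) * ofDual (b'.coord l'.succ))
      = -(ofVec (b' i'.succ) * ofDual (b'.coord l.succ) *
        (ofVec (b' i.succ) * ofDual (b'.coord l'.succ)))
    have h1 : ∀ u v : W, (ofVec u * ofDual (b'.coord l.succ) *
        (ofVec v * ofDual (b'.coord l'.succ)) : Lam n W)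
        = -(ofVec u * ofVec v) * (ofDual (b'.coord l.succ) * ofDual (b'.coord l'.succ)) := by
      intro u v
      have := ofVec_anti (n := n) (W := W) (0, 0, b'.coord l.succ) (0, v, 0)
      change ofDual _ * ofVec _ = -(ofVec _ * ofDual _) at this
      rw [mul_assoc, ← mul_assoc (ofDual _) (ofVec v), this]
      simp only [neg_mul, mul_neg, mul_assoc]
    rw [h1, h1, show (ofVec (b' i.succ) * ofVec (b' i'.succ) : Lam n W)
      = -(ofVec (b' i'.succ) * ofVec (b' i.succ)) from ofVec_anti _ _]
    simp only [neg_mul]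
  have hz0 : ∀ i l l', z i l * z i l' = 0 := by
    intro i l l'
    apply Subtype.ext
    change ofVec (b' i.succ) * ofDual (b'.coord l.succ) *
      (ofVec (b' i.succ) * ofDual (b'.coord l'.succ)) = 0
    rw [← mul_assoc, (mem_center_iff.mp (hzmem i l) (ofVec (b' i.succ))).eq, ← mul_assoc,
      ofVec_mul_ofVec_self, zero_mul, zero_mul]
  have hysq : ∀ l, y l * y l = 0 := by
    intro l
    have hyd : ((y l : Subalgebra.center ℂ (Lam n W)) : Lam n W)
        = (∑ i, ofForm (A i l) * ofVec (b' i.succ)) * ofDual (b'.coord l.succ) := by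
      rw [AddSubmonoidClass.coe_finsetSum, Finset.sum_mul]
      exact Finset.sum_congr rfl fun i _ => (mul_assoc _ _ _).symm
    apply Subtype.ext
    change (y l : Lam n W) * (y l : Lam n W) = 0
    nth_rewrite 2 [hyd]
    rw [← mul_assoc, (mem_center_iff.mp (y l).2 _).eq, mul_assoc, hyd, mul_assoc,
      ofDual_mul_ofDual_self, mul_zero, mul_zero]
  -- After `M̃` is written with the dual basis of `b'`, the summand ending in `b'₀*` and the
  -- contributions of `c` along `b'₀` are killed by `pf`. Thus no condition is needed on the image
  -- of `b'₀`, and only `A` survives.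
  have hpT : pf * tildeEnd b M = pf * ((∑ l, y l : Subalgebra.center ℂ (Lam n W)) : Lam n W) := by
    rw [tildeEnd_eq_sum_basis b b', Fin.sum_univ_succ, mul_add]
    have h0 : ∀ u : Lam n W, pf * (u * ofDual (b'.coord 0)) = 0 := by
      intro u
      rw [← mul_assoc, (hpfc u).eq, hpf, mul_assoc, mul_assoc, ofDual_mul_ofDual_self, mul_zero,
        mul_zero]
    have h0' : ∀ u w : Lam n W, pf * (u * ofVec (b' 0) * w) = 0 := by
      intro u w
      rw [← mul_assoc, ← mul_assoc, (hpfc u).eq, mul_assoc u, (hpfc (ofVec (b' 0))).eq, hpf,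
        ← mul_assoc (ofVec _) (ofVec _), ofVec_mul_ofVec_self]
      simp
    rw [h0, zero_add, AddSubmonoidClass.coe_finsetSum, Finset.mul_sum, Finset.mul_sum]
    refine Finset.sum_congr rfl fun l _ => ?_
    rw [hMA, add_mul, mul_add, h0', add_zero, AddSubmonoidClass.coe_finsetSum, Finset.sum_mul]
    congr 1
    exact Finset.sum_congr rfl fun i _ => mul_assoc _ _ _
  have hpk : ∀ k, pf * tildeEnd b M ^ k
      = pf * (((∑ l, y l) ^ k : Subalgebra.center ℂ (Lam n W)) : Lam n W) := fun k => by
    rw [central_mul_pow hpfc hpT, SubmonoidClass.coe_pow]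
  have hsum := sum_pow_of_sq_zero y hysq Finset.univ
  rw [Finset.card_univ, Fintype.card_fin] at hsum
  -- `pf` is the missing index-zero factor of the full product of pairs, which is the top-degree
  -- generator.
  have hprod : pf * ((∏ l, z l l : Subalgebra.center ℂ (Lam n W)) : Lam n W)
      = (((r + 1).factorial : ℂ))⁻¹ • (tildeEnd b 1 : Lam n W) ^ (r + 1) := by
    rw [tildeEnd_one_basis b b', tildeEnd_one_pow, ← List.ofFn_eq_map, List.ofFn_succ,
      List.prod_cons, ← List.prod_ofFn, ← Subalgebra.coe_val, map_list_prod, List.map_ofFn]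
    rfl
  -- Only the squarefree monomial of `(∑ y l) ^ r` survives; its coefficient `r!` cancels the one of
  -- the exponential.
  have htop : ((r.factorial : ℂ))⁻¹ • (pf * tildeEnd b M ^ r)
      = ofForm (detForm A) * (((r + 1).factorial : ℂ)⁻¹ • tildeEnd b 1 ^ (r + 1)) := by
    rw [hpk, hsum.1, ← hprod, ofForm_detForm A B fun _ _ => rfl, prod_sum_mul_eq_det z hz0 hz1 B]
    rw [← mul_assoc (B.det : Lam n W) pf, (mem_center_iff.mp B.det.2 pf).eq, mul_assoc pf]
    change _ • (pf * (((r.factorial : Subalgebra.center ℂ (Lam n W)) : Lam n W) *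
      ((B.det : Lam n W) * ((∏ l, z l l : Subalgebra.center ℂ (Lam n W)) : Lam n W)))) = _
    rw [SubringClass.coe_natCast, ← nsmul_eq_mul, mul_smul_comm, ← Nat.cast_smul_eq_nsmul ℂ,
      smul_smul, inv_mul_cancel₀ (by exact_mod_cast r.factorial_ne_zero), one_smul]
  -- The sum runs over `k = 0, …, r + 1`. The term `k = r + 1` dies after multiplication by `pf`, `k
  -- = r` is the main term, and the others form the part of lower degree.
  rw [expNil_eq_sum _ _ (tildeEnd_pow_eq_zero b M hM), Finset.sum_range_succ,
    Finset.sum_range_succ, mul_add, mul_add, mul_smul_comm, mul_smul_comm, htop, hpk (r + 1),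
    hsum.2, ZeroMemClass.coe_zero, mul_zero, smul_zero, add_zero, add_comm (pf * _)]
  refine berezin_eq b _ _ ?_
  rw [Finset.mul_sum]
  refine sum_mem fun k hk => ?_
  rw [mul_smul_comm]
  refine Submodule.smul_mem _ _ ?_
  rw [hpf, mul_assoc]
  -- With the two vectors of `pf` the degree is at most `2k + 2`, which is below `2(r + 1)` since `k
  -- < r`.
  refine lowDeg_mono ?_ (ι_mul_mem_lowDeg (b' 0, 0) (ι_mul_mem_lowDeg (0, b'.coord 0)
    (tildeEnd_pow_mem_lowDeg b M k)))
  have := Finset.mem_range.mp hk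
  omega

theorem ofForm_oneForm_anti (a : Cot n) (v : W) :
    (ofVec v * ofForm (oneForm a) : Lam n W) = -(ofForm (oneForm a) * ofVec v) := by
  unfold oneForm
  rw [ofForm_ι]
  exact ofVec_anti _ _

/-- The sign comes from moving the one-form `η k` past the vector `b j`. -/
theorem tildeVec_mul_tildeDual (b : Module.Basis (Fin m) ℂ W) (ξ η : Fin m → Cot n) :
    (tildeVec b ξ * tildeDual b η : Lam n W)
      = -tildeEnd b (Matrix.of fun j k => oneForm (ξ j) * oneForm (η k)) := by
  unfold tildeVec tildeDual tildeEnd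
  rw [Finset.sum_mul_sum, ← Finset.sum_neg_distrib]
  refine Finset.sum_congr rfl fun j _ => ?_
  rw [← Finset.sum_neg_distrib]
  refine Finset.sum_congr rfl fun k _ => ?_
  rw [Matrix.of_apply, map_mul, mul_assoc, ← mul_assoc (ofVec _), ofForm_oneForm_anti]
  simp only [neg_mul, mul_neg, mul_assoc]

theorem tildeEnd_add (b : Module.Basis (Fin m) ℂ W) (M N : Matrix (Fin m) (Fin m) (Form n)) :
    (tildeEnd b (M + N) : Lam n W) = tildeEnd b M + tildeEnd b N := by
  simp [tildeEnd, add_mul, Finset.sum_add_distrib]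

theorem tildeEnd_smul (b : Module.Basis (Fin m) ℂ W) (c : ℂ)
    (M : Matrix (Fin m) (Fin m) (Form n)) :
    (tildeEnd b (c • M) : Lam n W) = c • tildeEnd b M := by
  simp [tildeEnd, Finset.smul_sum]

end BerezinDet

/-! ### Exterior calculus of matrices of functions and of one-forms -/

section Calculus

variable {n : ℕ} {ι κ μ : Type*}

theorem oneForm_add (a c : Cot n) : oneForm (a + c) = oneForm a + oneForm c := map_add _ _ _

theorem oneForm_sub (a c : Cot n) : oneForm (a - c) = oneForm a - oneForm c := map_sub _ _ _

theorem oneForm_smul (u : ℂ) (a : Cot n) : oneForm (u • a) = u • oneForm a := map_smul _ _ _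

theorem oneForm_sum {s : Finset ι} (a : ι → Cot n) :
    oneForm (∑ i ∈ s, a i) = ∑ i ∈ s, oneForm (a i) := map_sum (ExteriorAlgebra.ι ℂ) _ _

theorem oneForm_zero : oneForm (0 : Cot n) = 0 := map_zero (ExteriorAlgebra.ι ℂ)

theorem oneForm_injective : Function.Injective (oneForm : Cot n → Form n) :=
  ExteriorAlgebra.ι_leftInverse.injective

theorem oneForm_anti (a c : Cot n) : oneForm a * oneForm c = -(oneForm c * oneForm a) :=
  eq_neg_of_add_eq_zero_left (ExteriorAlgebra.ι_add_mul_swap a c)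

/-- The real coordinate vectors of `ℂⁿ`. -/
def vecR : Fin n ⊕ Fin n → Coord n := Sum.elim vecX vecY

/-- The differentials of the real coordinates of `ℂⁿ`. -/
def dR : Fin n ⊕ Fin n → Cot n := Sum.elim dX dY

/-- A real-linear covector is determined by its values on the `2n` real coordinate vectors. -/
theorem cot_eq_sum (L : Cot n) : L = ∑ i, L (vecR i) • dR i := by
  ext v
  have hv : v = ∑ j, ((v j).re • vecX j + (v j).im • vecY j) := by
    ext k
    simp only [vecX, vecY, PiLp.add_apply, WithLp.ofLp_sum, Finset.sum_apply, PiLp.smul_apply,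
      PiLp.single_apply]
    rw [Finset.sum_eq_single k]
    · simp [Complex.re_add_im]
    · intro j _ hj
      simp [hj.symm]
    · simp
  conv_lhs => rw [hv]
  rw [Fintype.sum_sum_type]
  simp [vecR, dR, dX, dY, Finset.sum_add_distrib, mul_comm]

theorem extD_eq_sum (α : Coord n → Cot n) (p : Coord n) :
    extD α p = ∑ i, oneForm (dR i) * oneForm (fderiv ℝ α p (vecR i)) := by
  rw [Fintype.sum_sum_type]
  exact Finset.sum_add_distrib

theorem extD_smul {u : Coord n → ℂ} {α : Coord n → Cot n} {p : Coord n}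
    (hu : DifferentiableAt ℝ u p) (hα : DifferentiableAt ℝ α p) :
    extD (fun q => u q • α q) p
      = oneForm (fderiv ℝ u p) * oneForm (α p) + u p • extD α p := by
  rw [extD_eq_sum, extD_eq_sum, fderiv_fun_smul hu hα]
  conv_rhs => rw [cot_eq_sum (fderiv ℝ u p), oneForm_sum, Finset.sum_mul, Finset.smul_sum]
  rw [← Finset.sum_add_distrib]
  refine Finset.sum_congr rfl fun i _ => ?_
  rw [_root_.add_apply, oneForm_add, mul_add, add_comm]
  congr 1
  · rw [ContinuousLinearMap.smulRight_apply, oneForm_smul, oneForm_smul, smul_mul_assoc,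
      mul_smul_comm]
  · rw [_root_.smul_apply, oneForm_smul, mul_smul_comm]

theorem extD_sum {s : Finset ι} {α : ι → Coord n → Cot n} {p : Coord n}
    (h : ∀ i ∈ s, DifferentiableAt ℝ (α i) p) :
    extD (fun q => ∑ i ∈ s, α i q) p = ∑ i ∈ s, extD (α i) p := by
  simp only [extD_eq_sum]
  rw [fderiv_fun_sum h, Finset.sum_comm]
  refine Finset.sum_congr rfl fun i _ => ?_
  rw [_root_.sum_apply, oneForm_sum, Finset.mul_sum]

theorem extD_add {α β : Coord n → Cot n} {p : Coord n} (hα : DifferentiableAt ℝ α p)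
    (hβ : DifferentiableAt ℝ β p) : extD (fun q => α q + β q) p = extD α p + extD β p := by
  simp only [extD_eq_sum]
  rw [fderiv_fun_add hα hβ, ← Finset.sum_add_distrib]
  refine Finset.sum_congr rfl fun i _ => ?_
  rw [_root_.add_apply, oneForm_add, mul_add]

theorem extD_sub {α β : Coord n → Cot n} {p : Coord n} (hα : DifferentiableAt ℝ α p)
    (hβ : DifferentiableAt ℝ β p) : extD (fun q => α q - β q) p = extD α p - extD β p := by
  simp only [extD_eq_sum]
  rw [fderiv_fun_sub hα hβ, ← Finset.sum_sub_distrib]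
  refine Finset.sum_congr rfl fun i _ => ?_
  rw [_root_.sub_apply, oneForm_sub, mul_sub]

theorem extD_congr {α β : Coord n → Cot n} {p : Coord n} (h : α =ᶠ[nhds p] β) :
    extD α p = extD β p := by
  rw [extD_eq_sum, extD_eq_sum, h.fderiv_eq]

/-- The symmetric second derivative is paired with antisymmetric products, so the form equals its
own negative. -/
theorem extD_fderiv {u : Coord n → ℂ} {p : Coord n} (hu : ContDiffAt ℝ 2 u p) :
    extD (fun q => fderiv ℝ u q) p = 0 := by
  have hs : IsSymmSndFDerivAt ℝ u p := hu.isSymmSndFDerivAt (by simp)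
  set c : Fin n ⊕ Fin n → Fin n ⊕ Fin n → ℂ :=
    fun i k => fderiv ℝ (fderiv ℝ u) p (vecR i) (vecR k)
  have hx : extD (fun q => fderiv ℝ u q) p
      = ∑ i, ∑ k, c i k • (oneForm (dR i) * oneForm (dR k)) := by
    rw [extD_eq_sum]
    refine Finset.sum_congr rfl fun i _ => ?_
    conv_lhs => rw [cot_eq_sum (fderiv ℝ (fun q => fderiv ℝ u q) p (vecR i)), oneForm_sum,
      Finset.mul_sum]
    refine Finset.sum_congr rfl fun k _ => ?_
    rw [oneForm_smul, mul_smul_comm]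
  have hneg : extD (fun q => fderiv ℝ u q) p = -extD (fun q => fderiv ℝ u q) p := by
    conv_lhs => rw [hx, Finset.sum_comm]
    rw [hx, ← Finset.sum_neg_distrib]
    refine Finset.sum_congr rfl fun i _ => ?_
    rw [← Finset.sum_neg_distrib]
    refine Finset.sum_congr rfl fun k _ => ?_
    rw [oneForm_anti (dR k), smul_neg]
    congr 2
    exact hs _ _
  have h2 : (2 : ℂ) • extD (fun q => fderiv ℝ u q) p = 0 := by
    rw [two_smul]
    nth_rewrite 1 [hneg]
    exact neg_add_cancel _
  exact (smul_eq_zero.mp h2).resolve_left two_ne_zero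

/-- `part01` as a complex-linear map. -/
def part01ₗ (n : ℕ) : Cot n →ₗ[ℂ] Cot n := LinearMap.id - part10ₗ n

theorem part01ₗ_apply (L : Cot n) : part01ₗ n L = part01 L := by
  change L - part10 L = _
  rw [sub_eq_iff_eq_add', part10_add_part01]

theorem continuous_part10ₗ (n : ℕ) : Continuous (part10ₗ n) :=
  LinearMap.continuous_of_finiteDimensional ((part10ₗ n).restrictScalars ℝ)

theorem continuous_part01ₗ (n : ℕ) : Continuous (part01ₗ n) :=
  LinearMap.continuous_of_finiteDimensional ((part01ₗ n).restrictScalars ℝ)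

/-- A matrix of scalars as a matrix of forms. -/
def scalarMat (n : ℕ) (A : Matrix ι κ ℂ) : Matrix ι κ (Form n) := A.map (algebraMap ℂ (Form n))

/-- A matrix of covectors as a matrix of forms. -/
def covMat (α : Matrix ι κ (Cot n)) : Matrix ι κ (Form n) := α.map oneForm

/-- The product of a matrix of scalars and a matrix of covectors. -/
def smulL [Fintype κ] (A : Matrix ι κ ℂ) (α : Matrix κ μ (Cot n)) : Matrix ι μ (Cot n) :=
  Matrix.of fun i j => ∑ k, A i k • α k j

/-- The product of a matrix of covectors and a matrix of scalars. -/
def smulR [Fintype κ] (α : Matrix ι κ (Cot n)) (A : Matrix κ μ ℂ) : Matrix ι μ (Cot n) :=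
  Matrix.of fun i j => ∑ k, A k j • α i k

/-- The matrix of the differentials of the entries, followed by a projection `P`. -/
def gradMat (P : Cot n →ₗ[ℂ] Cot n) (A : Coord n → Matrix ι κ ℂ) (p : Coord n) :
    Matrix ι κ (Cot n) :=
  Matrix.of fun i j => P (fderiv ℝ (fun q => A q i j) p)

/-- The matrix of the exterior derivatives of the entries. -/
def extDMat (α : Coord n → Matrix ι κ (Cot n)) (p : Coord n) : Matrix ι κ (Form n) :=
  Matrix.of fun i j => extD (fun q => α q i j) p

theorem scalarMat_mul [Fintype κ] (A : Matrix ι κ ℂ) (B : Matrix κ μ ℂ) :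
    (scalarMat n (A * B) : Matrix ι μ (Form n)) = scalarMat n A * scalarMat n B :=
  Matrix.map_mul

theorem scalarMat_add (A B : Matrix ι κ ℂ) :
    (scalarMat n (A + B) : Matrix ι κ (Form n)) = scalarMat n A + scalarMat n B :=
  Matrix.map_add _ (map_add _) _ _

theorem scalarMat_sub (A B : Matrix ι κ ℂ) :
    (scalarMat n (A - B) : Matrix ι κ (Form n)) = scalarMat n A - scalarMat n B :=
  Matrix.map_sub _ (map_sub _) _ _

theorem scalarMat_zero : (scalarMat n (0 : Matrix ι κ ℂ) : Matrix ι κ (Form n)) = 0 :=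
  Matrix.map_zero _ (map_zero _)

theorem scalarMat_one [DecidableEq ι] :
    (scalarMat n (1 : Matrix ι ι ℂ) : Matrix ι ι (Form n)) = 1 :=
  Matrix.map_one _ (map_zero _) (map_one _)

theorem covMat_smulL [Fintype κ] (A : Matrix ι κ ℂ) (α : Matrix κ μ (Cot n)) :
    covMat (smulL A α) = scalarMat n A * covMat α := by
  ext1 i j
  rw [Matrix.mul_apply]
  change oneForm (∑ k, A i k • α k j) = ∑ k, algebraMap ℂ (Form n) (A i k) * oneForm (α k j)
  simp only [oneForm_sum, oneForm_smul, Algebra.smul_def]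

theorem covMat_smulR [Fintype κ] (α : Matrix ι κ (Cot n)) (A : Matrix κ μ ℂ) :
    covMat (smulR α A) = covMat α * scalarMat n A := by
  ext1 i j
  rw [Matrix.mul_apply]
  change oneForm (∑ k, A k j • α i k) = ∑ k, oneForm (α i k) * algebraMap ℂ (Form n) (A k j)
  simp only [oneForm_sum, oneForm_smul, Algebra.smul_def, Algebra.commutes]

theorem covMat_add (α β : Matrix ι κ (Cot n)) : covMat (α + β) = covMat α + covMat β :=
  Matrix.map_add _ oneForm_add _ _

theorem covMat_sub (α β : Matrix ι κ (Cot n)) : covMat (α - β) = covMat α - covMat β :=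
  Matrix.map_sub _ oneForm_sub _ _

theorem covMat_zero : covMat (0 : Matrix ι κ (Cot n)) = 0 :=
  Matrix.map_zero _ oneForm_zero

/-- Lets identities between matrices of covectors be proved over the ring of forms, where matrix
multiplication makes sense. -/
theorem covMat_injective : Function.Injective (covMat : Matrix ι κ (Cot n) → _) :=
  Matrix.map_injective oneForm_injective

/-- All the entries of a matrix of functions are differentiable. -/
def DiffMat {V : Type*} [NormedAddCommGroup V] [NormedSpace ℝ V]
    (A : Coord n → Matrix ι κ V) (p : Coord n) : Prop :=
  ∀ i j, DifferentiableAt ℝ (fun q => A q i j) p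

theorem gradMat_congr (P : Cot n →ₗ[ℂ] Cot n) {A B : Coord n → Matrix ι κ ℂ} {p : Coord n}
    (h : A =ᶠ[nhds p] B) : gradMat P A p = gradMat P B p := by
  ext1 i j
  have : (fun q => A q i j) =ᶠ[nhds p] fun q => B q i j := h.mono fun q hq => by simp only [hq]
  simp only [gradMat, Matrix.of_apply, this.fderiv_eq]

theorem gradMat_const (P : Cot n →ₗ[ℂ] Cot n) (A : Matrix ι κ ℂ) (p : Coord n) :
    gradMat P (fun _ => A) p = 0 := by
  ext1 i j
  simp [gradMat]

theorem gradMat_sub (P : Cot n →ₗ[ℂ] Cot n) {A B : Coord n → Matrix ι κ ℂ} {p : Coord n}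
    (hA : DiffMat A p) (hB : DiffMat B p) :
    gradMat P (fun q => A q - B q) p = gradMat P A p - gradMat P B p := by
  ext1 i j
  simp only [gradMat, Matrix.of_apply, Matrix.sub_apply]
  rw [fderiv_fun_sub (hA i j) (hB i j), map_sub]

theorem DiffMat.mul [Fintype κ] {A : Coord n → Matrix ι κ ℂ} {B : Coord n → Matrix κ μ ℂ}
    {p : Coord n} (hA : DiffMat A p) (hB : DiffMat B p) : DiffMat (fun q => A q * B q) p := by
  intro i j
  simp only [Matrix.mul_apply]
  exact DifferentiableAt.fun_sum fun k _ => (hA i k).fun_mul (hB k j)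

theorem DiffMat.sub {A B : Coord n → Matrix ι κ ℂ}
    {p : Coord n} (hA : DiffMat A p) (hB : DiffMat B p) : DiffMat (fun q => A q - B q) p :=
  fun i j => (hA i j).sub (hB i j)

theorem DiffMat.congr {V : Type*} [NormedAddCommGroup V] [NormedSpace ℝ V]
    {A B : Coord n → Matrix ι κ V} {p : Coord n} (hA : DiffMat A p)
    (h : B =ᶠ[nhds p] A) : DiffMat B p := fun i j =>
  (hA i j).congr_of_eventuallyEq (h.mono fun q hq => by simp only [hq])

theorem DiffMat.conjTranspose {A : Coord n → Matrix ι κ ℂ} {p : Coord n} (hA : DiffMat A p) :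
    DiffMat (fun q => (A q).conjTranspose) p := fun i j =>
  (Complex.conjCLE : ℂ →L[ℝ] ℂ).differentiableAt.comp p (hA j i)

/-- The product rule. -/
theorem covMat_gradMat_mul [Fintype κ] (P : Cot n →ₗ[ℂ] Cot n) {A : Coord n → Matrix ι κ ℂ}
    {B : Coord n → Matrix κ μ ℂ} {p : Coord n} (hA : DiffMat A p) (hB : DiffMat B p) :
    covMat (gradMat P (fun q => A q * B q) p)
      = covMat (gradMat P A p) * scalarMat n (B p) + scalarMat n (A p) * covMat (gradMat P B p) := by
  rw [← covMat_smulR, ← covMat_smulL, ← covMat_add]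
  congr 1
  ext1 i j
  simp only [gradMat, smulL, smulR, Matrix.of_apply, Matrix.add_apply, Matrix.mul_apply]
  rw [fderiv_fun_sum fun k _ => (hA i k).fun_mul (hB k j), map_sum, ← Finset.sum_add_distrib]
  refine Finset.sum_congr rfl fun k _ => ?_
  rw [fderiv_fun_mul (hA i k) (hB k j), map_add, map_smul, map_smul, add_comm]

/-- Conjugation exchanges the types `(1,0)` and `(0,1)`. Hence the adjoint of a holomorphic matrix
behaves as a constant under `∂`. -/
theorem gradMat_conjTranspose_eq_zero {A : Coord n → Matrix ι κ ℂ} {p : Coord n}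
    (hA : DiffMat A p) (h : gradMat (part01ₗ n) A p = 0) :
    gradMat (part10ₗ n) (fun q => (A q).conjTranspose) p = 0 := by
  ext1 i j
  have h1 : part01 (fderiv ℝ (fun q => A q j i) p) = 0 := by
    rw [← part01ₗ_apply]
    exact congrFun (congrFun h j) i
  have h2 : fderiv ℝ (fun q => (A q).conjTranspose i j) p
      = conjCot (fderiv ℝ (fun q => A q j i) p) :=
    ((Complex.conjCLE : ℂ →L[ℝ] ℂ).hasFDerivAt.comp p (hA j i).hasFDerivAt).fderiv
  change part10 (fderiv ℝ (fun q => (A q).conjTranspose i j) p) = 0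
  rw [h2]
  exact part10_conj h1

theorem gradMat_id (A : Coord n → Matrix ι κ ℂ) (p : Coord n) :
    gradMat LinearMap.id A p = gradMat (part10ₗ n) A p + gradMat (part01ₗ n) A p := by
  ext1 i j
  exact (add_sub_cancel (part10 (fderiv ℝ (fun q => A q i j) p)) _).symm

theorem extDMat_congr {α β : Coord n → Matrix ι κ (Cot n)} {p : Coord n}
    (h : α =ᶠ[nhds p] β) : extDMat α p = extDMat β p := by
  ext1 i j
  exact extD_congr (h.mono fun q hq => by simp only [hq])

theorem extDMat_add {α β : Coord n → Matrix ι κ (Cot n)} {p : Coord n}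
    (hα : DiffMat α p) (hβ : DiffMat β p) :
    extDMat (fun q => α q + β q) p = extDMat α p + extDMat β p := by
  ext1 i j
  exact extD_add (hα i j) (hβ i j)

theorem extDMat_sub {α β : Coord n → Matrix ι κ (Cot n)} {p : Coord n}
    (hα : DiffMat α p) (hβ : DiffMat β p) :
    extDMat (fun q => α q - β q) p = extDMat α p - extDMat β p := by
  ext1 i j
  exact extD_sub (hα i j) (hβ i j)

theorem DiffMat.smulL [Fintype κ] {A : Coord n → Matrix ι κ ℂ} {α : Coord n → Matrix κ μ (Cot n)}
    {p : Coord n} (hA : DiffMat A p) (hα : DiffMat α p) :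
    DiffMat (fun q => smulL (A q) (α q)) p := fun i j =>
  DifferentiableAt.fun_sum fun k _ => (hA i k).fun_smul (hα k j)

theorem DiffMat.smulR [Fintype κ] {A : Coord n → Matrix κ μ ℂ} {α : Coord n → Matrix ι κ (Cot n)}
    {p : Coord n} (hα : DiffMat α p) (hA : DiffMat A p) :
    DiffMat (fun q => smulR (α q) (A q)) p := fun i j =>
  DifferentiableAt.fun_sum fun k _ => (hA k j).fun_smul (hα i k)

theorem extDMat_smulL [Fintype κ] {A : Coord n → Matrix ι κ ℂ} {α : Coord n → Matrix κ μ (Cot n)}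
    {p : Coord n} (hA : DiffMat A p) (hα : DiffMat α p) :
    extDMat (fun q => smulL (A q) (α q)) p
      = covMat (gradMat LinearMap.id A p) * covMat (α p) + scalarMat n (A p) * extDMat α p := by
  ext1 i j
  change extD (fun q => ∑ k, A q i k • α q k j) p = _
  rw [extD_sum fun k _ => (hA i k).fun_smul (hα k j), Matrix.add_apply, Matrix.mul_apply,
    Matrix.mul_apply, ← Finset.sum_add_distrib]
  refine Finset.sum_congr rfl fun k _ => ?_
  rw [extD_smul (hA i k) (hα k j), Algebra.smul_def]
  rfl

/-- The minus sign comes from exchanging the one-forms `dA` and `α`. -/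
theorem extDMat_smulR [Fintype κ] {A : Coord n → Matrix κ μ ℂ} {α : Coord n → Matrix ι κ (Cot n)}
    {p : Coord n} (hα : DiffMat α p) (hA : DiffMat A p) :
    extDMat (fun q => smulR (α q) (A q)) p
      = extDMat α p * scalarMat n (A p) - covMat (α p) * covMat (gradMat LinearMap.id A p) := by
  ext1 i j
  change extD (fun q => ∑ k, A q k j • α q i k) p = _
  rw [extD_sum fun k _ => (hA k j).fun_smul (hα i k), Matrix.sub_apply, Matrix.mul_apply,
    Matrix.mul_apply, ← Finset.sum_sub_distrib]
  refine Finset.sum_congr rfl fun k _ => ?_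
  rw [extD_smul (hA k j) (hα i k), Algebra.smul_def, oneForm_anti, Algebra.commutes, add_comm,
    ← sub_eq_add_neg]
  rfl

theorem extDMat_gradMat_id {A : Coord n → Matrix ι κ ℂ} {p : Coord n}
    (hA : ∀ i j, ContDiffAt ℝ 2 (fun q => A q i j) p) :
    extDMat (fun q => gradMat LinearMap.id A q) p = 0 := by
  ext1 i j
  exact extD_fderiv (hA i j)

theorem diffMat_gradMat (P : Cot n →ₗ[ℂ] Cot n) (hP : Continuous P) {A : Coord n → Matrix ι κ ℂ}
    {p : Coord n} (hA : ∀ i j, ContDiffAt ℝ 2 (fun q => A q i j) p) :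
    DiffMat (fun q => gradMat P A q) p := by
  intro i j
  have h1 : DifferentiableAt ℝ (fderiv ℝ (fun q => A q i j)) p :=
    ((hA i j).fderiv_right (m := 1) (by norm_num)).differentiableAt (by norm_num)
  exact ((⟨P.restrictScalars ℝ, hP⟩ : Cot n →L[ℝ] Cot n).differentiableAt).comp p h1

end Calculus

/-! ### The curvature of the quotient -/

/-- The difference `L` of the two sides is orthogonal to `f`, by differentiating `⟨w_l, f⟩ = 0`, and
to the lifts `s_k`, by differentiating `⟨w_l, s_k⟩ = g`. Hence it is orthogonal to a spanning set
and vanishes. Here `dh`, `dW`, `dhW` and `dg` stand for `(1,0)`-derivatives. -/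
theorem quot_connection_algebra {R : Type*} [Ring R] {m r u : Type*} [Fintype m] [Fintype r]
    [Fintype u] [DecidableEq m] [DecidableEq r] {h θ dh : Matrix m m R}
    {F : Matrix m u R} {σ Fs : Matrix u m R}
    {W dW dhW : Matrix m r R} {g g' θQ dg : Matrix r r R} {Ω Ss Ws : Matrix r m R}
    {σSs : Matrix r u R} {a : Matrix u u R}
    (h1 : dhW = dh * W + h * dW) (h2 : Fs * dhW = 0) (h3 : Ss * dhW = dg)
    (hθ : h * θ = dh) (hθQ : g * θQ = dg) (hFW : Fs * (h * W) = 0) (hσ : σ = a * (Fs * h))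
    (hWs : Ws = Ss - σSs * Fs) (hg : g = Ss * (h * W)) (hg' : g' * g = 1)
    (hΩ : 1 = F * σ + W * Ω) : θ * W + dW = W * θQ := by
  rw [← sub_eq_zero]
  set L := θ * W + dW - W * θQ with hL
  have hgW : g = Ws * (h * W) := by
    rw [hWs, Matrix.sub_mul, Matrix.mul_assoc, hFW, Matrix.mul_zero, sub_zero, hg]
  have hhL : h * L = dhW - h * W * θQ := by
    rw [hL, Matrix.mul_sub, Matrix.mul_add, ← Matrix.mul_assoc h θ, hθ, h1, Matrix.mul_assoc h W]
  have hFL : Fs * (h * L) = 0 := by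
    rw [hhL, Matrix.mul_sub, h2, ← Matrix.mul_assoc Fs, hFW, Matrix.zero_mul, sub_zero]
  have hσL : σ * L = 0 := by
    rw [hσ, Matrix.mul_assoc, Matrix.mul_assoc, hFL, Matrix.mul_zero]
  have hWL : Ws * (h * L) = 0 := by
    rw [hWs, Matrix.sub_mul, Matrix.mul_assoc σSs, hFL, Matrix.mul_zero, sub_zero, hhL,
      Matrix.mul_sub, h3, ← Matrix.mul_assoc Ss, ← hg, hθQ, sub_self]
  -- The component of `L` along `f` is `σ * L = 0`, so `L` is a combination of the columns of `W`;
  -- invertibility of their Gram matrix `g` then forces the coefficients `Ω * L` to vanish.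
  have hLW : L = W * (Ω * L) := by
    calc L = (F * σ + W * Ω) * L := by rw [← hΩ, Matrix.one_mul]
      _ = W * (Ω * L) := by
        rw [Matrix.add_mul, Matrix.mul_assoc, hσL, Matrix.mul_zero, zero_add, Matrix.mul_assoc]
  have hΩL : Ω * L = 0 := by
    rw [hLW, ← Matrix.mul_assoc h, ← Matrix.mul_assoc Ws, ← hgW] at hWL
    calc Ω * L = g' * (g * (Ω * L)) := by rw [← Matrix.mul_assoc, hg', Matrix.one_mul]
      _ = 0 := by rw [hWL, Matrix.mul_zero]
  rw [hLW, hΩL, Matrix.mul_zero]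

/-- The hypothesis `h2` is the exterior derivative of the connection identity `h1`. Eliminating `dW`
between them completes `dθ` and `dθQ` to curvatures and `dF` to a covariant derivative; the rest is
a multiple of `F`. -/
theorem quot_curvature_algebra {R : Type*} [Ring R] {m r u : Type*} [Fintype m] [Fintype r]
    [Fintype u] {θ dθ : Matrix m m R} {F dF : Matrix m u R}
    {W dW : Matrix m r R} {θQ dθQ : Matrix r r R} {τ dτ : Matrix u r R}
    (h1 : θ * W + dW = W * θQ - F * τ)
    (h2 : dθ * W - θ * dW = dW * θQ + W * dθQ - (dF * τ + F * dτ)) :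
    (dθ + θ * θ) * W + (dF + θ * F) * τ = W * (dθQ + θQ * θQ) + F * -(dτ + τ * θQ) := by
  have e1 : dW = W * θQ - F * τ - θ * W := by rw [← h1]; abel
  have e2 : dθ * W = θ * dW + dW * θQ + W * dθQ - (dF * τ + F * dτ) := by
    rw [sub_eq_iff_eq_add.mp h2]
    abel
  rw [Matrix.add_mul, e2, e1]
  simp only [Matrix.add_mul, Matrix.mul_add, Matrix.sub_mul, Matrix.mul_sub, Matrix.mul_assoc,
    Matrix.mul_neg]
  abel

section QuotientCurvature

variable {n m r : ℕ}

/-- Pointwise linear algebra of the splitting `E = ℂ f ⊕ f^⊥` in a frame of `E`: here `h` is the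
transposed Gram matrix of the frame, `F` the column of coefficients of `f`, the columns of `S` lift a
frame of the quotient, those of `W` are their projections to `f^⊥`, `σ` is the row of
coefficients of the dual vector of minimal norm, and `g` is the transposed Gram matrix of the
quotient. -/
structure IsSplitting (h : Matrix (Fin m) (Fin m) ℂ) (F : Matrix (Fin m) (Fin 1) ℂ)
    (S W : Matrix (Fin m) (Fin r) ℂ) (σ : Matrix (Fin 1) (Fin m) ℂ)
    (g : Matrix (Fin r) (Fin r) ℂ) : Prop where
  isUnit_h : IsUnit h.det
  isUnit_g : IsUnit g.det
  W_eq : W = S - F * (σ * S)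
  σF : σ * F = 1
  exists_σ_eq : ∃ a : Matrix (Fin 1) (Fin 1) ℂ, σ = a * (F.conjTranspose * h)
  FhW : F.conjTranspose * (h * W) = 0
  g_eq : g = S.conjTranspose * (h * W)
  exists_span : ∃ Ω : Matrix (Fin r) (Fin m) ℂ, 1 = F * σ + W * Ω

/-- The defining relation `h θ = ∂h` of the Chern connection. -/
theorem scalarMat_mul_chernConnection (H : Coord n → Matrix (Fin r) (Fin r) ℂ) (p : Coord n)
    (hdet : IsUnit (H p).transpose.det) :
    scalarMat n (H p).transpose * covMat (chernConnection H p)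
      = covMat (gradMat (part10ₗ n) (fun q => (H q).transpose) p) := by
  have hθ : chernConnection H p
      = smulL (H p).transpose⁻¹ (gradMat (part10ₗ n) (fun q => (H q).transpose) p) := by
    ext1 i j
    rw [← Matrix.transpose_nonsing_inv]
    rfl
  rw [hθ, covMat_smulL, ← Matrix.mul_assoc, ← scalarMat_mul, Matrix.mul_nonsing_inv _ hdet,
    scalarMat_one, Matrix.one_mul]

variable {H : Coord n → Matrix (Fin m) (Fin m) ℂ} {F : Coord n → Matrix (Fin m) (Fin 1) ℂ}
  {S W : Coord n → Matrix (Fin m) (Fin r) ℂ} {σ : Coord n → Matrix (Fin 1) (Fin m) ℂ}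
  {G : Coord n → Matrix (Fin r) (Fin r) ℂ} {p : Coord n}

/-- The covariant derivative of the orthogonal representatives of a frame of the quotient. -/
theorem quot_connection (hsp : ∀ᶠ q in nhds p,
      IsSplitting (H q).transpose (F q) (S q) (W q) (σ q) (G q).transpose)
    (dH : DiffMat (fun q => (H q).transpose) p) (dF : DiffMat F p) (dS : DiffMat S p)
    (dσ : DiffMat σ p) (hF : gradMat (part01ₗ n) F p = 0) (hS : gradMat (part01ₗ n) S p = 0) :
    smulR (chernConnection H p) (W p) + gradMat LinearMap.id W p
      = smulL (W p) (chernConnection G p)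
        - smulL (F p) (smulR (gradMat (part01ₗ n) σ p) (S p)) := by
  have hp := hsp.self_of_nhds
  have hWe : W =ᶠ[nhds p] fun q => S q - F q * (σ q * S q) := hsp.mono fun q hq => hq.W_eq
  have dW : DiffMat W p := (dS.sub (dF.mul (dσ.mul dS))).congr hWe
  have dhW : DiffMat (fun q => (H q).transpose * W q) p := dH.mul dW
  have dFs := dF.conjTranspose
  have dSs := dS.conjTranspose
  -- In `W = S - F (σ S)` only `σ` fails to be holomorphic.
  have hW01 : covMat (gradMat (part01ₗ n) W p)
      = -(scalarMat n (F p) * (covMat (gradMat (part01ₗ n) σ p) * scalarMat n (S p))) := by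
    rw [gradMat_congr _ hWe, gradMat_sub _ dS (dF.mul (dσ.mul dS)), covMat_sub, hS,
      covMat_gradMat_mul _ dF (dσ.mul dS), hF, covMat_gradMat_mul _ dσ dS, hS]
    simp only [covMat_zero, Matrix.mul_zero, Matrix.zero_mul, add_zero, zero_add, zero_sub]
  -- This is `∂` applied to the orthogonality relation; the antiholomorphic factor passes through.
  have h2 : scalarMat n (F p).conjTranspose *
      covMat (gradMat (part10ₗ n) (fun q => (H q).transpose * W q) p) = 0 := by
    have he : (fun q => (F q).conjTranspose * ((H q).transpose * W q)) =ᶠ[nhds p] fun _ => 0 :=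
      hsp.mono fun q hq => hq.FhW
    have h := covMat_gradMat_mul (part10ₗ n) dFs dhW
    rw [gradMat_congr _ he, gradMat_const, gradMat_conjTranspose_eq_zero dF hF, covMat_zero,
      covMat_zero, Matrix.zero_mul, zero_add] at h
    exact h.symm
  have h3 : scalarMat n (S p).conjTranspose *
      covMat (gradMat (part10ₗ n) (fun q => (H q).transpose * W q) p)
        = covMat (gradMat (part10ₗ n) (fun q => (G q).transpose) p) := by
    have he : (fun q => (G q).transpose) =ᶠ[nhds p]
        fun q => (S q).conjTranspose * ((H q).transpose * W q) := hsp.mono fun q hq => hq.g_eq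
    rw [gradMat_congr _ he, covMat_gradMat_mul (part10ₗ n) dSs dhW,
      gradMat_conjTranspose_eq_zero dS hS, covMat_zero, Matrix.zero_mul, zero_add]
  obtain ⟨a, ha⟩ := hp.exists_σ_eq
  obtain ⟨Ω, hΩ⟩ := hp.exists_span
  -- This settles the `(1,0)`-part of the covariant derivative of `W`; the `(0,1)`-part is `hW01`.
  have key := quot_connection_algebra (covMat_gradMat_mul (part10ₗ n) dH dW) h2 h3
    (scalarMat_mul_chernConnection H p hp.isUnit_h)
    (scalarMat_mul_chernConnection G p hp.isUnit_g)
    (by rw [← scalarMat_mul, ← scalarMat_mul, hp.FhW, scalarMat_zero])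
    (by rw [← scalarMat_mul, ← scalarMat_mul, ← ha])
    (Ws := scalarMat n (W p).conjTranspose)
    (σSs := scalarMat n (σ p * S p).conjTranspose)
    (by rw [← scalarMat_mul, ← Matrix.conjTranspose_mul, ← scalarMat_sub,
          ← Matrix.conjTranspose_sub, ← hp.W_eq])
    (by rw [← scalarMat_mul, ← scalarMat_mul, ← hp.g_eq])
    (g' := scalarMat n (G p).transpose⁻¹)
    (by rw [← scalarMat_mul, Matrix.nonsing_inv_mul _ hp.isUnit_g, scalarMat_one])
    (Ω := scalarMat n Ω)
    (by rw [← scalarMat_mul, ← scalarMat_mul, ← scalarMat_add, ← hΩ, scalarMat_one])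
  apply covMat_injective
  rw [covMat_add, covMat_sub, covMat_smulR, covMat_smulL, covMat_smulL, covMat_smulR, gradMat_id,
    covMat_add, hW01, ← key]
  abel

/-- The curvature of the quotient is induced by `Θ + Df ∧ ∂̄σ`. -/
theorem quot_curvature (hsp : ∀ᶠ q in nhds p,
      IsSplitting (H q).transpose (F q) (S q) (W q) (σ q) (G q).transpose)
    (cH : ∀ i j, ContDiffAt ℝ 2 (fun q => H q i j) p)
    (cF : ∀ i j, ContDiffAt ℝ 2 (fun q => F q i j) p)
    (cS : ∀ i j, ContDiffAt ℝ 2 (fun q => S q i j) p)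
    (cσ : ∀ i j, ContDiffAt ℝ 2 (fun q => σ q i j) p)
    (cW : ∀ i j, ContDiffAt ℝ 2 (fun q => W q i j) p)
    (dθ : DiffMat (chernConnection H) p) (dθQ : DiffMat (chernConnection G) p)
    (hF : ∀ᶠ q in nhds p, gradMat (part01ₗ n) F q = 0)
    (hS : ∀ᶠ q in nhds p, gradMat (part01ₗ n) S q = 0) :
    ∃ c : Matrix (Fin 1) (Fin r) (Form n),
      (chernCurvature H p
          + covMat (gradMat LinearMap.id F p + smulR (chernConnection H p) (F p))
            * covMat (gradMat (part01ₗ n) σ p)) * scalarMat n (W p)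
        = scalarMat n (W p) * chernCurvature G p + scalarMat n (F p) * c := by
  have ev : ∀ {a b : ℕ} {A : Coord n → Matrix (Fin a) (Fin b) ℂ},
      (∀ i j, ContDiffAt ℝ 2 (fun q => A q i j) p) → ∀ᶠ q in nhds p, DiffMat A q := by
    intro a b A hA
    refine Filter.eventually_all.mpr fun i => Filter.eventually_all.mpr fun j => ?_
    exact ((hA i j).eventually (by simp)).mono fun q hq => hq.differentiableAt (by norm_num)
  have hcont : Continuous (part01ₗ n) := continuous_part01ₗ n
  set τ : Coord n → Matrix (Fin 1) (Fin r) (Cot n) :=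
    fun q => smulR (gradMat (part01ₗ n) σ q) (S q) with hτ
  -- The connection identity is needed on a whole neighbourhood, because it is about to be
  -- differentiated.
  have h1 : (fun q => smulR (chernConnection H q) (W q) + gradMat LinearMap.id W q) =ᶠ[nhds p]
      fun q => smulL (W q) (chernConnection G q) - smulL (F q) (τ q) := by
    filter_upwards [eventually_eventually_nhds.mpr hsp, ev cH, ev cF, ev cS, ev cσ, hF, hS]
      with q h0 h1 h2 h3 h4 h5 h6
    exact quot_connection h0 (fun i j => h1 j i) h2 h3 h4 h5 h6
  have dF := (ev cF).self_of_nhds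
  have dS := (ev cS).self_of_nhds
  have dσ := (ev cσ).self_of_nhds
  have dW := (ev cW).self_of_nhds
  have dτ : DiffMat τ p := (diffMat_gradMat _ hcont cσ).smulR dS
  have h2 := extDMat_congr h1
  rw [extDMat_add (dθ.smulR dW) (diffMat_gradMat _ continuous_id cW), extDMat_gradMat_id cW,
    add_zero, extDMat_sub (dW.smulL dθQ) (dF.smulL dτ), extDMat_smulR dθ dW, extDMat_smulL dW dθQ,
    extDMat_smulL dF dτ] at h2
  have h1' := congrArg covMat h1.self_of_nhds
  simp only [covMat_add, covMat_sub, covMat_smulR, covMat_smulL] at h1'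
  have key := quot_curvature_algebra h1' h2
  have hp := hsp.self_of_nhds
  -- Apply `∂̄` to `σ F = 1` with `F` holomorphic. Consequently `∂̄σ` takes the same values on `W`
  -- as on `S`.
  have hσF : covMat (gradMat (part01ₗ n) σ p) * scalarMat n (F p) = 0 := by
    have h := covMat_gradMat_mul (part01ₗ n) dσ dF
    have he : (fun q => σ q * F q) =ᶠ[nhds p] fun _ => 1 := hsp.mono fun q hq => hq.σF
    rw [gradMat_congr _ he, gradMat_const, hF.self_of_nhds, covMat_zero, covMat_zero,
      Matrix.mul_zero, add_zero] at h
    exact h.symm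
  have hσW : covMat (gradMat (part01ₗ n) σ p) * scalarMat n (W p) = covMat (τ p) := by
    rw [hp.W_eq, scalarMat_sub, scalarMat_mul, Matrix.mul_sub, ← Matrix.mul_assoc, hσF,
      Matrix.zero_mul, sub_zero, hτ, covMat_smulR]
  refine ⟨-(extDMat τ p + covMat (τ p) * covMat (chernConnection G p)), ?_⟩
  rw [Matrix.add_mul, Matrix.mul_assoc (covMat _), hσW, covMat_add, covMat_smulR]
  exact key

end QuotientCurvature

/-! ### Linear algebra in a fibre -/

section Fibre

theorem extD_mem_center {n : ℕ} {W : Type*} [AddCommGroup W] [Module ℂ W] (α : Coord n → Cot n)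
    (p : Coord n) : (ofForm (extD α p) : Lam n W) ∈ Subalgebra.center ℂ (Lam n W) := by
  rw [extD_eq_sum, map_sum]
  exact sum_mem fun i _ => ofForm_oneForm_mul_mem_center _ _

theorem curvature_mem_center {n r : ℕ} {W : Type*} [AddCommGroup W] [Module ℂ W]
    (θ : Coord n → Matrix (Fin r) (Fin r) (Cot n)) (p : Coord n) (j k : Fin r) :
    (ofForm (curvature θ p j k) : Lam n W) ∈ Subalgebra.center ℂ (Lam n W) := by
  unfold curvature
  rw [Matrix.of_apply, map_add, map_sum]
  exact add_mem (extD_mem_center _ _) (sum_mem fun i _ => ofForm_oneForm_mul_mem_center _ _)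

theorem one_mem_center {n r : ℕ} {W : Type*} [AddCommGroup W] [Module ℂ W] (j k : Fin r) :
    (ofForm ((1 : Matrix (Fin r) (Fin r) (Form n)) j k) : Lam n W)
      ∈ Subalgebra.center ℂ (Lam n W) := by
  rw [Matrix.one_apply]
  split_ifs
  · rw [map_one]; exact one_mem _
  · rw [map_zero]; exact zero_mem _

/-- Scaling the curvature relation by `ℵ` and adding the identity shows that `I + ℵ(Θ + ξ ∧ η)`
induces `I + ℵ ΘQ` modulo `b' 0`, which is the hypothesis of `berezin_expNil_eq_detForm`. -/
theorem detForm_eq_berezin {n m r : ℕ} {W : Type*} [AddCommGroup W] [Module ℂ W]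
    (b : Module.Basis (Fin m) ℂ W) (b' : Module.Basis (Fin (r + 1)) ℂ W)
    {Θ : Matrix (Fin m) (Fin m) (Form n)} {ΘQ : Matrix (Fin r) (Fin r) (Form n)}
    (hΘ : ∀ j k, (ofForm (Θ j k) : Lam n W) ∈ Subalgebra.center ℂ (Lam n W))
    (hΘQ : ∀ j k, (ofForm (ΘQ j k) : Lam n W) ∈ Subalgebra.center ℂ (Lam n W))
    {ξ η : Fin m → Cot n} {F : Matrix (Fin m) (Fin 1) ℂ} {S : Matrix (Fin m) (Fin r) ℂ}
    (hF : ∀ i, b.coord i (b' 0) = F i 0) (hS : ∀ i l, b.coord i (b' (Fin.succ l)) = S i l)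
    {c : Matrix (Fin 1) (Fin r) (Form n)}
    (h : (Θ + Matrix.of fun j k => oneForm (ξ j) * oneForm (η k)) * scalarMat n S
      = scalarMat n S * ΘQ + scalarMat n F * c) :
    detForm (1 + aleph • ΘQ) = berezin b (ofVec (b' 0) * ofDual (b'.coord 0) *
      expNil (tildeEnd b 1 + aleph • tildeEnd b Θ - aleph • (tildeVec b ξ * tildeDual b η))) := by
  set B : Matrix (Fin m) (Fin m) (Form n) :=
    Θ + Matrix.of fun j k => oneForm (ξ j) * oneForm (η k) with hB
  have hBc : ∀ j k, (ofForm (B j k) : Lam n W) ∈ Subalgebra.center ℂ (Lam n W) := by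
    intro j k
    rw [hB, Matrix.add_apply, map_add]
    exact add_mem (hΘ j k) (ofForm_oneForm_mul_mem_center _ _)
  -- The explicit minus sign cancels against the one from `tildeVec_mul_tildeDual`.
  have hexp : (tildeEnd b 1 + aleph • tildeEnd b Θ - aleph • (tildeVec b ξ * tildeDual b η) :
      Lam n W) = tildeEnd b (1 + aleph • B) := by
    rw [tildeEnd_add, tildeEnd_smul, hB, tildeEnd_add, tildeVec_mul_tildeDual, smul_neg,
      sub_neg_eq_add, smul_add, add_assoc]
  have hMS : (1 + aleph • B) * scalarMat n S
      = scalarMat n S * (1 + aleph • ΘQ) + scalarMat n F * (aleph • c) := by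
    rw [Matrix.add_mul, Matrix.mul_add, Matrix.one_mul, Matrix.mul_one, Matrix.smul_mul, h,
      smul_add, Matrix.mul_smul, Matrix.mul_smul, add_assoc]
  rw [hexp]
  have hvec : ∀ k, (ofVec (b' k) : Lam n W) = ∑ j, b.coord j (b' k) • ofVec (b j) := by
    intro k
    conv_lhs => rw [← b.sum_repr (b' k), ofVec_sum_smul]
    rfl
  refine (berezin_expNil_eq_detForm b b' (1 + aleph • B) (1 + aleph • ΘQ)
    (fun l => (aleph • c) 0 l) ?_ ?_ ?_).symm
  · intro j k
    rw [Matrix.add_apply, map_add, Matrix.smul_apply, map_smul]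
    exact add_mem (one_mem_center j k) (smul_mem_center _ (hBc j k))
  · intro j k
    rw [Matrix.add_apply, map_add, Matrix.smul_apply, map_smul]
    exact add_mem (one_mem_center j k) (smul_mem_center _ (hΘQ j k))
  · intro l
    set P : Matrix (Fin m) (Fin r) (Form n) := (1 + aleph • B) * scalarMat n S with hP
    have hL : ∀ j, ∑ i, b.coord i (b' l.succ) • (1 + aleph • B) j i = P j l := by
      intro j
      rw [hP, Matrix.mul_apply]
      refine Finset.sum_congr rfl fun i _ => ?_
      rw [hS, Algebra.smul_def, Algebra.commutes]
      rfl
    have hR : ∀ j, P j l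
        = ∑ i, S j i • (1 + aleph • ΘQ) i l + F j 0 • (aleph • c) 0 l := by
      intro j
      rw [hMS, Matrix.add_apply, Matrix.mul_apply, Matrix.mul_apply, Fin.sum_univ_one,
        Algebra.smul_def]
      simp only [Algebra.smul_def]
      rfl
    simp only [hL, hR]
    simp only [hvec, hS, hF, map_add, map_sum, map_smul, add_mul, Finset.sum_mul,
      Finset.mul_sum, Finset.sum_add_distrib, smul_mul_assoc, mul_smul_comm]
    rw [Finset.sum_comm]

/-! ### Orthogonal splitting of a Hermitian space along a vector -/

namespace HermInner

variable {W : Type*} [AddCommGroup W] [Module ℂ W] (g : HermInner W)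

/-- A vector in the left kernel gives a combination of the `e j` orthogonal to every `e k`, hence to
itself, hence zero. -/
theorem isUnit_det_gram {r : ℕ} {e : Fin r → W} (he : LinearIndependent ℂ e) :
    IsUnit (Matrix.of fun j k => g.form (e j) (e k)).det := by
  rw [isUnit_iff_ne_zero]
  intro h0
  obtain ⟨c, hc, hc0⟩ := Matrix.exists_vecMul_eq_zero_iff.mpr h0
  refine hc ?_
  have hk : ∀ k, g.form (∑ j, c j • e j) (e k) = 0 := by
    intro k
    rw [map_sum, LinearMap.sum_apply]
    simpa [Matrix.vecMul, dotProduct] using congrFun hc0 k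
  have hz : ∑ j, c j • e j = 0 := by
    by_contra hne
    refine g.self_ne_zero hne ?_
    rw [map_sum (g.form (∑ j, c j • e j))]
    refine Finset.sum_eq_zero fun k _ => ?_
    rw [map_smulₛₗ, hk, smul_zero]
  exact funext (Fintype.linearIndependent_iff.mp he c hz)

theorem proj_eq (v ξ : W) : g.proj v ξ = ξ - g.minDual v ξ • v := rfl

theorem form_proj_left {v : W} (hv : v ≠ 0) (ξ : W) : g.form (g.proj v ξ) v = 0 := by
  rw [proj_eq, map_sub, map_smul, LinearMap.sub_apply, LinearMap.smul_apply, minDual_apply,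
    smul_eq_mul, mul_right_comm, inv_mul_cancel₀ (g.self_ne_zero hv), one_mul, sub_self]

theorem form_proj_proj {v : W} (hv : v ≠ 0) (ξ ζ : W) :
    g.form (g.proj v ξ) (g.proj v ζ) = g.form (g.proj v ξ) ζ := by
  conv_lhs => rw [g.proj_eq v ζ]
  rw [map_sub, map_smulₛₗ, form_proj_left g hv, smul_zero, sub_zero]

variable {m r : ℕ} (b : Module.Basis (Fin m) ℂ W)

/-- Inner products as matrix products. The Gram matrix is transposed because the form is linear in
its first argument and the coordinates of the conjugate-linear argument stand on the left. -/
theorem gram_mul_apply {ι κ : Type*} (u : ι → W) (w : κ → W) (i : ι) (k : κ) :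
    ((Matrix.of fun j k => b.repr (w k) j).conjTranspose *
      ((Matrix.of fun j k => g.form (b j) (b k)).transpose * Matrix.of fun j i => b.repr (u i) j))
      k i = g.form (u i) (w k) := by
  conv_rhs => rw [← b.sum_repr (u i), ← b.sum_repr (w k)]
  simp only [Matrix.mul_apply, Matrix.conjTranspose_apply, Matrix.transpose_apply,
    Matrix.of_apply, map_sum, map_smulₛₗ, LinearMap.sum_apply, LinearMap.smul_apply,
    smul_eq_mul, Complex.star_def, RingHom.id_apply]
  refine Finset.sum_congr rfl fun j _ => ?_
  congr 1
  exact Finset.sum_congr rfl fun l _ => mul_comm _ _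

variable {v : W} (s : Fin r → W) (q : Module.Basis (Fin r) ℂ (W ⧸ Submodule.span ℂ {v}))

/-- The projection of `ξ` to the complement of `v` is the lift of its class, which is expanded in
the basis `q`. -/
theorem eq_minDual_add_sum (hq : ∀ l, q l = Submodule.Quotient.mk (s l)) (ξ : W) :
    ξ = g.minDual v ξ • v + ∑ l, q.repr (Submodule.Quotient.mk ξ) l • g.proj v (s l) := by
  have h1 : g.proj v ξ = ∑ l, q.repr (Submodule.Quotient.mk ξ) l • g.proj v (s l) := by
    rw [← lift_mk]
    conv_lhs => rw [← q.sum_repr (Submodule.Quotient.mk ξ)]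
    rw [map_sum]
    refine Finset.sum_congr rfl fun l _ => ?_
    rw [map_smul, hq, lift_mk]
  rw [← h1, proj_eq, add_sub_cancel]

/-- The splitting of `W` into the line of `v` and its orthogonal complement. -/
theorem isSplitting (hv : v ≠ 0) (hq : ∀ l, q l = Submodule.Quotient.mk (s l)) :
    IsSplitting (Matrix.of fun j k => g.form (b j) (b k)).transpose
      (Matrix.of fun i (_ : Fin 1) => b.repr v i) (Matrix.of fun i l => b.repr (s l) i)
      (Matrix.of fun i l => b.repr (g.proj v (s l)) i)
      (Matrix.of fun (_ : Fin 1) k => g.minDual v (b k))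
      (Matrix.of fun j k => (g.quot v).form (q j) (q k)).transpose := by
  have hσ : ∀ ξ, ∑ k, g.minDual v (b k) * b.repr ξ k = g.minDual v ξ := by
    intro ξ
    conv_rhs => rw [← b.sum_repr ξ, map_sum]
    exact Finset.sum_congr rfl fun k _ => by rw [map_smul, smul_eq_mul, mul_comm]
  have hquot : ∀ j k, (g.quot v).form (q j) (q k) = g.form (g.proj v (s j)) (g.proj v (s k)) := by
    intro j k
    rw [hq, hq]
    rfl
  refine ⟨?_, ?_, ?_, ?_, ?_, ?_, ?_, ?_⟩
  · rw [Matrix.det_transpose]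
    exact g.isUnit_det_gram b.linearIndependent
  · rw [Matrix.det_transpose]
    exact (g.quot v).isUnit_det_gram q.linearIndependent
  · ext i l
    simp only [Matrix.of_apply, Matrix.sub_apply, Matrix.mul_apply, Fin.sum_univ_one, hσ, proj_eq,
      map_sub, map_smul, Finsupp.sub_apply, Finsupp.smul_apply, smul_eq_mul]
    ring
  · ext i j
    rw [Matrix.mul_apply, Subsingleton.elim i j, Matrix.one_apply_eq]
    exact (hσ v).trans (g.minDual_self v hv)
  -- The scalar is `1 / |v|²`, since `σ = ⟨·, v⟩ / |v|²`.
  · refine ⟨Matrix.of fun _ _ => (g.form v v)⁻¹, ?_⟩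
    ext i k
    have hone : (Matrix.of fun j k => b.repr (b k) j) = (1 : Matrix (Fin m) (Fin m) ℂ) := by
      ext j k
      rw [Matrix.of_apply, b.repr_self, Matrix.one_apply, Finsupp.single_apply]
      simp only [eq_comm]
    have h := g.gram_mul_apply b b (fun _ : Fin 1 => v) k 0
    rw [hone, Matrix.mul_one] at h
    rw [Matrix.mul_apply, Fin.sum_univ_one, h]
    rfl
  · ext i l
    rw [g.gram_mul_apply b (fun l => g.proj v (s l)) (fun _ : Fin 1 => v)]
    exact g.form_proj_left hv _
  · ext k l
    rw [g.gram_mul_apply b (fun l => g.proj v (s l)) s, Matrix.transpose_apply, Matrix.of_apply,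
      hquot, g.form_proj_proj hv]
  -- The rows of the witness are the coordinates, with respect to `q`, of the classes of the `b k`.
  · refine ⟨Matrix.of fun l k => q.repr (Submodule.Quotient.mk (b k)) l, ?_⟩
    ext i k
    have h := congrArg (fun ξ => b.repr ξ i) (g.eq_minDual_add_sum s q hq (b k))
    simp only [map_add, map_smul, map_sum, Finsupp.add_apply, Finsupp.smul_apply,
      Finsupp.finsetSum_apply, smul_eq_mul, b.repr_self, Finsupp.single_apply, eq_comm (a := k)] at h
    rw [Matrix.add_apply, Matrix.mul_apply, Matrix.mul_apply, Fin.sum_univ_one, Matrix.one_apply]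
    simp only [Matrix.of_apply]
    rw [h, mul_comm]
    congr 1
    exact Finset.sum_congr rfl fun l _ => mul_comm _ _

/-- The basis formed by `v` and the orthogonal representatives of a basis of the quotient. -/
def splitBasis (hv : v ≠ 0) (hq : ∀ l, q l = Submodule.Quotient.mk (s l)) :
    Module.Basis (Fin (r + 1)) ℂ W :=
  Module.Basis.ofEquivFun
    { toFun := fun ξ => Fin.cons (g.minDual v ξ) fun l => q.repr (Submodule.Quotient.mk ξ) l
      map_add' := by
        intro ξ ζ
        ext i
        refine Fin.cases ?_ (fun l => ?_) i
        · simp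
        · simp
      map_smul' := by
        intro c ξ
        ext i
        refine Fin.cases ?_ (fun l => ?_) i
        · simp
        · simp
      invFun := fun c => c 0 • v + ∑ l : Fin r, c l.succ • g.proj v (s l)
      left_inv := fun ξ => by
        simpa using (g.eq_minDual_add_sum s q hq ξ).symm
      right_inv := fun c => by
        have h0 : ∀ ξ, g.minDual v (g.proj v ξ) = 0 := fun ξ => by
          rw [minDual_apply, g.form_proj_left hv, mul_zero]
        have h1 : ∀ l, (Submodule.Quotient.mk (g.proj v (s l)) : W ⧸ Submodule.span ℂ {v})
            = q l := fun l => by rw [← lift_mk, mk_lift, hq]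
        have hv0 : (Submodule.Quotient.mk v : W ⧸ Submodule.span ℂ {v}) = 0 :=
          (Submodule.Quotient.mk_eq_zero _).mpr (Submodule.mem_span_singleton_self v)
        have hmk : (Submodule.Quotient.mk (c 0 • v + ∑ l : Fin r, c l.succ • g.proj v (s l)) :
            W ⧸ Submodule.span ℂ {v}) = ∑ l : Fin r, c l.succ • q l := by
          rw [← Submodule.mkQ_apply, map_add, map_smul, map_sum]
          simp only [map_smul, Submodule.mkQ_apply, h1, hv0, smul_zero, zero_add]
        ext i
        refine Fin.cases ?_ (fun l => ?_) i
        · simp [h0, g.minDual_self v hv]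
        · beta_reduce
          rw [Fin.cons_succ, hmk, map_sum, Finsupp.finsetSum_apply, Finset.sum_eq_single l]
          · simp
          · intro k _ hk
            simp [Finsupp.single_eq_of_ne hk.symm]
          · simp }

/-- This is why orthogonal representatives are used: with arbitrary lifts the dual vector of `v`
need not be the one of minimal norm. -/
theorem splitBasis_coord_zero (hv : v ≠ 0) (hq : ∀ l, q l = Submodule.Quotient.mk (s l)) :
    (g.splitBasis s q hv hq).coord 0 = g.minDual v := by
  ext ξ
  simp [splitBasis]

theorem splitBasis_zero (hv : v ≠ 0) (hq : ∀ l, q l = Submodule.Quotient.mk (s l)) :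
    g.splitBasis s q hv hq 0 = v := by
  simp [splitBasis]

theorem splitBasis_succ (hv : v ≠ 0) (hq : ∀ l, q l = Submodule.Quotient.mk (s l)) (l : Fin r) :
    g.splitBasis s q hv hq l.succ = g.proj v (s l) := by
  simp [splitBasis, Pi.single_apply]

end HermInner

end Fibre

/-! ### Smoothness in charts -/

section Smoothness

theorem contDiffAt_det {𝕜 V : Type*} [NontriviallyNormedField 𝕜] [NormedAlgebra 𝕜 ℂ]
    [NormedAddCommGroup V] [NormedSpace 𝕜 V] {k : ℕ∞ω} {m : ℕ}
    {A : V → Matrix (Fin m) (Fin m) ℂ} {p : V}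
    (hA : ∀ i j, ContDiffAt 𝕜 k (fun q => A q i j) p) :
    ContDiffAt 𝕜 k (fun q => (A q).det) p := by
  simp only [Matrix.det_apply']
  exact ContDiffAt.sum fun τ _ => contDiffAt_const.mul (contDiffAt_prod fun i _ => hA _ _)

/-- By Cramer's rule. It is needed over `ℝ` for the Chern connection and over `ℂ` for coefficients
of holomorphic sections. -/
theorem contDiffAt_matrix_inv {𝕜 V : Type*} [NontriviallyNormedField 𝕜] [NormedAlgebra 𝕜 ℂ]
    [NormedAddCommGroup V] [NormedSpace 𝕜 V] {k : ℕ∞ω} {m : ℕ}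
    {A : V → Matrix (Fin m) (Fin m) ℂ} {p : V}
    (hA : ∀ i j, ContDiffAt 𝕜 k (fun q => A q i j) p) (hdet : IsUnit (A p).det) (i j : Fin m) :
    ContDiffAt 𝕜 k (fun q => (A q)⁻¹ i j) p := by
  have hinv : ∀ q, (A q)⁻¹ i j
      = (A q).det⁻¹ * ((A q).updateRow j (Pi.single i 1)).det := by
    intro q
    rw [Matrix.inv_def, Matrix.smul_apply, Matrix.adjugate_apply, Ring.inverse_eq_inv',
      smul_eq_mul]
  simp only [hinv]
  refine ((contDiffAt_det hA).inv hdet.ne_zero).mul (contDiffAt_det fun i' j' => ?_)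
  by_cases h : i' = j
  · subst h
    simp only [Matrix.updateRow_self]
    exact contDiffAt_const
  · simp only [Matrix.updateRow_ne h]
    exact hA i' j'

theorem diffMat_chernConnection {n r : ℕ} {H : Coord n → Matrix (Fin r) (Fin r) ℂ} {p : Coord n}
    (hH : ∀ i j, ContDiffAt ℝ 2 (fun q => H q i j) p) (hdet : IsUnit (H p).det) :
    DiffMat (chernConnection H) p := by
  intro l j
  change DifferentiableAt ℝ (fun q => ∑ k, (H q)⁻¹ k l • del (fun q' => H q' j k) q) p
  refine DifferentiableAt.fun_sum fun k _ => DifferentiableAt.fun_smul ?_ ?_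
  · exact (contDiffAt_matrix_inv hH hdet k l).differentiableAt (by norm_num)
  · exact diffMat_gradMat _ (continuous_part10ₗ n) hH j k

/-- The Cauchy–Riemann equations: the real derivative is complex-linear. -/
theorem part01_fderiv_eq_zero {n : ℕ} {u : Coord n → ℂ} {p : Coord n}
    (hu : DifferentiableAt ℂ u p) : part01 (fderiv ℝ u p) = 0 := by
  rw [hu.fderiv_restrictScalars ℝ]
  ext v
  have hI := Complex.I_mul_I
  simp only [part01, cplxJ, _root_.smul_apply, _root_.add_apply, smul_eq_mul,
    ContinuousLinearMap.comp_apply, ContinuousLinearMap.coe_restrictScalars',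
    ContinuousLinearMap.id_apply, map_smul, _root_.zero_apply]
  linear_combination (1 / 2 : ℂ) * fderiv ℂ u p v * hI

theorem eventually_gradMat_part01_eq_zero {n a b : ℕ} {A : Coord n → Matrix (Fin a) (Fin b) ℂ}
    {p : Coord n} (hA : ∀ i j, ContDiffAt ℂ ω (fun q => A q i j) p) :
    ∀ᶠ q in nhds p, gradMat (part01ₗ n) A q = 0 := by
  have h : ∀ᶠ q in nhds p, ∀ i j, DifferentiableAt ℂ (fun q => A q i j) q := by
    refine Filter.eventually_all.mpr fun i => Filter.eventually_all.mpr fun j => ?_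
    exact ((hA i j).eventually (by simp)).mono fun q hq => hq.differentiableAt (by simp)
  filter_upwards [h] with q hq
  ext1 i j
  change part01ₗ n _ = 0
  rw [part01ₗ_apply, part01_fderiv_eq_zero (hq i j)]

variable {n m : ℕ} {X : Type*} [TopologicalSpace X] [ChartedSpace (Coord n) X]

theorem contDiffAt_comp_symm_of_contMDiffAt [IsManifold 𝓘(ℂ, Coord n) ω X]
    {V : Type*} [NormedAddCommGroup V] [NormedSpace ℂ V] {φ : X → V} {x : X}
    (hφ : ContMDiffAt 𝓘(ℂ, Coord n) 𝓘(ℂ, V) ω φ x) {ψ : OpenPartialHomeomorph X (Coord n)}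
    (hψ : ψ ∈ IsManifold.maximalAtlas 𝓘(ℂ, Coord n) ω X) (hx : x ∈ ψ.source) :
    ContDiffAt ℂ ω (fun p => φ (ψ.symm p)) (ψ x) := by
  rw [← contMDiffAt_iff_contDiffAt]
  refine ContMDiffAt.comp (ψ x) ?_
    (contMDiffAt_symm_of_mem_maximalAtlas hψ (ψ.map_source hx))
  rwa [ψ.left_inv hx]

/-- Real smoothness is read in the preferred chart at `x`. The passage to `ψ` is holomorphic, hence
real smooth, so the complex atlas suffices. -/
theorem contDiffAt_real_comp_symm_of_contMDiffAt [IsManifold 𝓘(ℂ, Coord n) ω X]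
    {φ : X → ℂ} {x : X} (hφ : ContMDiffAt 𝓘(ℝ, Coord n) 𝓘(ℝ, ℂ) ∞ φ x)
    {ψ : OpenPartialHomeomorph X (Coord n)}
    (hψ : ψ ∈ IsManifold.maximalAtlas 𝓘(ℂ, Coord n) ω X) (hx : x ∈ ψ.source) :
    ContDiffAt ℝ ∞ (fun p => φ (ψ.symm p)) (ψ x) := by
  set χ := chartAt (Coord n) x
  have hxχ : x ∈ χ.source := mem_chart_source _ x
  have h1 : ContDiffAt ℝ ∞ (fun p => φ (χ.symm p)) (χ x) := by
    have h : ContDiffWithinAt ℝ ∞ (fun p => φ (χ.symm p)) (Set.range id) (χ x) :=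
      (contMDiffAt_iff.mp hφ).2
    rwa [Set.range_id, contDiffWithinAt_univ] at h
  have h2 : ContDiffAt ℂ ω (fun p => χ (ψ.symm p)) (ψ x) :=
    contDiffAt_comp_symm_of_contMDiffAt
      (contMDiffAt_of_mem_maximalAtlas (IsManifold.chart_mem_maximalAtlas x) hxχ) hψ hx
  have h3 : ContDiffAt ℝ ∞ (fun p => χ (ψ.symm p)) (ψ x) :=
    (h2.restrict_scalars ℝ).of_le le_top
  have h4 : ContDiffAt ℝ ∞ (fun p => φ (χ.symm (χ (ψ.symm p)))) (ψ x) := by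
    refine ContDiffAt.comp (g := fun p => φ (χ.symm p)) (ψ x) ?_ h3
    rwa [ψ.left_inv hx]
  refine h4.congr_of_eventuallyEq ?_
  have hev : ∀ᶠ p in nhds (ψ x), ψ.symm p ∈ χ.source :=
    (ψ.continuousAt_symm (ψ.map_source hx)).eventually
      (by rw [ψ.left_inv hx]; exact χ.open_source.mem_nhds hxχ)
  filter_upwards [hev] with p hp
  rw [χ.left_inv hp]

variable {E : X → Type*} [TopologicalSpace (Bundle.TotalSpace (Fib m) E)]
  [∀ x, AddCommGroup (E x)] [∀ x, Module ℂ (E x)] [∀ x, TopologicalSpace (E x)]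
  [FiberBundle (Fib m) E]

theorem contDiffAt_form [IsManifold 𝓘(ℂ, Coord n) ω X] (h : HermitianMetric n m E) {U : Set X}
    (hU : IsOpen U) {s t : ∀ x, E x} (hs : HolOn n m s U) (ht : HolOn n m t U) {x : X} (hxU : x ∈ U)
    {ψ : OpenPartialHomeomorph X (Coord n)}
    (hψ : ψ ∈ IsManifold.maximalAtlas 𝓘(ℂ, Coord n) ω X) (hx : x ∈ ψ.source) :
    ContDiffAt ℝ 2 (fun p => (h.inner (ψ.symm p)).form (s (ψ.symm p)) (t (ψ.symm p))) (ψ x) :=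
  (contDiffAt_real_comp_symm_of_contMDiffAt
    ((h.smooth U hU s t hs ht).contMDiffAt (hU.mem_nhds hxU)) hψ hx).of_le
      (WithTop.coe_le_coe.2 le_top)

/-- The coefficients of a holomorphic section in a holomorphic frame are holomorphic. -/
theorem contDiffAt_coeff [IsManifold 𝓘(ℂ, Coord n) ω X] [VectorBundle ℂ (Fib m) E]
    [ContMDiffVectorBundle ω (Fib m) E 𝓘(ℂ, Coord n)] {U V : Set X} (hU : IsOpen U)
    (hV : IsOpen V) {e : Fin m → ∀ y, E y} (he : IsFrame (n := n) e U) {s : ∀ x, E x}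
    (hs : HolOn n m s V) {x : X} (hxU : x ∈ U) (hxV : x ∈ V)
    {ψ : OpenPartialHomeomorph X (Coord n)}
    (hψ : ψ ∈ IsManifold.maximalAtlas 𝓘(ℂ, Coord n) ω X) (hx : x ∈ ψ.source) (i : Fin m) :
    ContDiffAt ℂ ω (fun p => he.coeff i (ψ.symm p) (s (ψ.symm p))) (ψ x) := by
  set t := trivializationAt (Fib m) E x
  have hxt : x ∈ t.baseSet := FiberBundle.mem_baseSet_trivializationAt' x
  have key : ∀ {s : ∀ x, E x} {V : Set X}, IsOpen V → HolOn n m s V → x ∈ V → ∀ j : Fin m,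
      ContDiffAt ℂ ω (fun p => (t ⟨ψ.symm p, s (ψ.symm p)⟩).2 j) (ψ x) := by
    intro s V hV hs hxV j
    have h1 : ContMDiffAt 𝓘(ℂ, Coord n) 𝓘(ℂ, Fib m) ω (fun y => (t ⟨y, s y⟩).2) x :=
      (t.contMDiffAt_section_iff hxt).1 (hs.contMDiffAt (hV.mem_nhds hxV))
    have h2 := contDiffAt_comp_symm_of_contMDiffAt h1 hψ hx
    exact (contDiffAt_euclidean.mp h2) j
  -- The frame in a local trivialization; coefficients in the frame are `A⁻¹` applied to the
  -- trivialized section.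
  let A : Coord n → Matrix (Fin m) (Fin m) ℂ := fun p =>
    Matrix.of fun i j => (t ⟨ψ.symm p, e j (ψ.symm p)⟩).2 i
  have hA : ∀ i j, ContDiffAt ℂ ω (fun p => A p i j) (ψ x) :=
    fun i j => key hU (he.contMDiffOn j) hxU i
  have hlin : ∀ y (hy : y ∈ t.baseSet) (v : E y), (t ⟨y, v⟩).2 = t.linearEquivAt ℂ y hy v :=
    fun y hy v => rfl
  have hdet : IsUnit (A (ψ x)).det := by
    have hy : ψ.symm (ψ x) ∈ t.baseSet := by rwa [ψ.left_inv hx]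
    have hyU : ψ.symm (ψ x) ∈ U := by rwa [ψ.left_inv hx]
    let c := (he.toBasisAt hyU).map (t.linearEquivAt ℂ _ hy)
    have hc : A (ψ x) = (EuclideanSpace.basisFun (Fin m) ℂ).toBasis.toMatrix c := by
      ext i j
      rw [Module.Basis.toMatrix_apply, OrthonormalBasis.coe_toBasis_repr_apply,
        EuclideanSpace.basisFun_repr, Module.Basis.map_apply, he.toBasisAt_coe hyU]
      rfl
    rw [hc]
    exact (Module.Basis.isUnit_det _ _)
  have hsum : (fun p => he.coeff i (ψ.symm p) (s (ψ.symm p))) =ᶠ[nhds (ψ x)]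
      fun p => ∑ j, (A p)⁻¹ i j * (t ⟨ψ.symm p, s (ψ.symm p)⟩).2 j := by
    have hcont := ψ.continuousAt_symm (ψ.map_source hx)
    have hevU : ∀ᶠ p in nhds (ψ x), ψ.symm p ∈ U := hcont.eventually
      (by rw [ψ.left_inv hx]; exact hU.mem_nhds hxU)
    have hevt : ∀ᶠ p in nhds (ψ x), ψ.symm p ∈ t.baseSet := hcont.eventually
      (by rw [ψ.left_inv hx]; exact t.open_baseSet.mem_nhds hxt)
    have hevd : ∀ᶠ p in nhds (ψ x), (A p).det ≠ 0 :=
      (contDiffAt_det hA).continuousAt.eventually_ne hdet.ne_zero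
    filter_upwards [hevU, hevt, hevd] with p hpU hpt hpd
    have hvec : (fun j => (t ⟨ψ.symm p, s (ψ.symm p)⟩).2 j)
        = (A p).mulVec fun k => he.coeff k (ψ.symm p) (s (ψ.symm p)) := by
      funext j
      conv_lhs => rw [he.coeff_sum_eq s hpU, hlin _ hpt, map_sum]
      simp only [map_smul, WithLp.ofLp_sum, Finset.sum_apply, PiLp.smul_apply, smul_eq_mul,
        Matrix.mulVec, dotProduct]
      exact Finset.sum_congr rfl fun k _ => mul_comm _ _
    have h := congrArg (fun w => (A p)⁻¹.mulVec w) hvec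
    simp only [Matrix.mulVec_mulVec, Matrix.nonsing_inv_mul _ (isUnit_iff_ne_zero.mpr hpd),
      Matrix.one_mulVec] at h
    exact (congrFun h i).symm
  refine ContDiffAt.congr_of_eventuallyEq ?_ hsum
  exact ContDiffAt.sum fun j _ => (contDiffAt_matrix_inv hA hdet i j).mul (key hV hs hxV j)

end Smoothness

/-! ### Twice differentiable matrices -/

section SmoothMatrices

variable {n : ℕ} {ι κ μ : Type*} {p : Coord n}

/-- All the entries of a matrix of functions are twice continuously differentiable. -/
def C2Mat (A : Coord n → Matrix ι κ ℂ) (p : Coord n) : Prop :=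
  ∀ i j, ContDiffAt ℝ 2 (fun q => A q i j) p

theorem C2Mat.mul [Fintype κ] {A : Coord n → Matrix ι κ ℂ} {B : Coord n → Matrix κ μ ℂ}
    (hA : C2Mat A p) (hB : C2Mat B p) : C2Mat (fun q => A q * B q) p := by
  intro i j
  simp only [Matrix.mul_apply]
  exact ContDiffAt.sum fun k _ => (hA i k).mul (hB k j)

theorem C2Mat.sub {A B : Coord n → Matrix ι κ ℂ} (hA : C2Mat A p) (hB : C2Mat B p) :
    C2Mat (fun q => A q - B q) p :=
  fun i j => (hA i j).sub (hB i j)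

theorem C2Mat.transpose {A : Coord n → Matrix ι κ ℂ} (hA : C2Mat A p) :
    C2Mat (fun q => (A q).transpose) p :=
  fun i j => hA j i

theorem C2Mat.conjTranspose {A : Coord n → Matrix ι κ ℂ} (hA : C2Mat A p) :
    C2Mat (fun q => (A q).conjTranspose) p :=
  fun i j => (Complex.conjCLE : ℂ →L[ℝ] ℂ).contDiff.contDiffAt.comp p (hA j i)

theorem C2Mat.congr {A B : Coord n → Matrix ι κ ℂ} (hA : C2Mat A p) (h : B =ᶠ[nhds p] A) :
    C2Mat B p := fun i j =>
  (hA i j).congr_of_eventuallyEq (h.mono fun q hq => by simp only [hq])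

theorem c2Mat_of_contDiffAt_complex {A : Coord n → Matrix ι κ ℂ}
    (hA : ∀ i j, ContDiffAt ℂ ω (fun q => A q i j) p) : C2Mat A p :=
  fun i j => ((hA i j).restrict_scalars ℝ).of_le le_top

end SmoothMatrices

end

end ChernQuotient

/-! ### Assembly of the curvature relation and the fibre identity -/

theorem proposition4p2 {n m r : ℕ} {X : Type*} [TopologicalSpace X]
    [ChartedSpace (ChernQuotient.Coord n) X]
    [IsManifold 𝓘(ℂ, ChernQuotient.Coord n) ω X]
    {E : X → Type*} [TopologicalSpace (Bundle.TotalSpace (ChernQuotient.Fib m) E)]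
    [∀ x, AddCommGroup (E x)] [∀ x, Module ℂ (E x)] [∀ x, TopologicalSpace (E x)]
    [FiberBundle (ChernQuotient.Fib m) E] [VectorBundle ℂ (ChernQuotient.Fib m) E]
    [ContMDiffVectorBundle ω (ChernQuotient.Fib m) E 𝓘(ℂ, ChernQuotient.Coord n)]
    (h : ChernQuotient.HermitianMetric n m E)
    (f : ∀ x, E x) (hf : ChernQuotient.HolOn n m f Set.univ)
    (x : X) (hfx : f x ≠ 0)
    (ψ : OpenPartialHomeomorph X (ChernQuotient.Coord n))
    (hψ : ψ ∈ IsManifold.maximalAtlas 𝓘(ℂ, ChernQuotient.Coord n) ω X) (hxψ : x ∈ ψ.source)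
    (U : Set X) (hU : IsOpen U) (hxU : x ∈ U)
    (e : Fin m → ∀ y, E y) (he : ChernQuotient.IsFrame (n := n) e U)
    (V : Set X) (hV : IsOpen V) (hxV : x ∈ V)
    (q : Fin r → ∀ y, ChernQuotient.QuotFib f y)
    (hq : ChernQuotient.IsQuotFrame (n := n) (m := m) f q V) :
    ChernQuotient.chernFormQ h f q ψ x =
      ChernQuotient.intE he hxU
        (ChernQuotient.ofVec (f x) * ChernQuotient.ofDual (ChernQuotient.sigma h f x) *
          ChernQuotient.expNil
            (ChernQuotient.tildeI he hxU
              + ChernQuotient.aleph • ChernQuotient.tildeTheta h he ψ hxU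
              - ChernQuotient.aleph • (ChernQuotient.tildeD h he ψ hxU f *
                  ChernQuotient.tildeDelbar he ψ hxU (ChernQuotient.sigma h f)))) := by
  open ChernQuotient in
  -- Holomorphic lifts of the quotient frame, available only near `x`.
  choose N hNo hxN s hs hqs using fun j => hq.holomorphic j x hxV
  set H := localGram h.inner e ψ
  set G := localGram (quotMetric h f) q ψ
  let F : Coord n → Matrix (Fin m) (Fin 1) ℂ := fun p =>
    Matrix.of fun i _ => he.coeff i (ψ.symm p) (f (ψ.symm p))
  let S : Coord n → Matrix (Fin m) (Fin r) ℂ := fun p =>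
    Matrix.of fun i l => he.coeff i (ψ.symm p) (s l (ψ.symm p))
  let W : Coord n → Matrix (Fin m) (Fin r) ℂ := fun p =>
    Matrix.of fun i l => he.coeff i (ψ.symm p)
      ((h.inner (ψ.symm p)).proj (f (ψ.symm p)) (s l (ψ.symm p)))
  let τ : Coord n → Matrix (Fin 1) (Fin m) ℂ := fun p =>
    Matrix.of fun _ k => sigma h f (ψ.symm p) (e k (ψ.symm p))
  have hfU : HolOn n m f U := hf.mono (Set.subset_univ U)
  have hinv : ψ.symm (ψ x) = x := ψ.left_inv hxψ
  have hcont : ContinuousAt ψ.symm (ψ x) := ψ.continuousAt_symm (ψ.map_source hxψ)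
  have hnhds : ∀ {O : Set X}, IsOpen O → x ∈ O → ∀ᶠ p in nhds (ψ x), ψ.symm p ∈ O :=
    fun hO hxO => hcont.eventually (by rw [hinv]; exact hO.mem_nhds hxO)
  have cff : ContDiffAt ℝ 2
      (fun p => (h.inner (ψ.symm p)).form (f (ψ.symm p)) (f (ψ.symm p))) (ψ x) :=
    contDiffAt_form h hU hfU hfU hxU hψ hxψ
  have hff : (h.inner (ψ.symm (ψ x))).form (f (ψ.symm (ψ x))) (f (ψ.symm (ψ x))) ≠ 0 := by
    rw [hinv]
    exact (h.inner x).self_ne_zero hfx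
  have hf0 : ∀ᶠ p in nhds (ψ x), f (ψ.symm p) ≠ 0 :=
    (cff.continuousAt.eventually_ne hff).mono fun p hp h0 => hp (by rw [h0, map_zero])
  have hcoeff : ∀ {y : X} (hy : y ∈ U) (i : Fin m) (v : E y),
      he.coeff i y v = (he.toBasisAt hy).repr v i := by
    intro y hy i v
    rw [IsLocalFrameOn.coeff, dif_pos hy]
    rfl
  have hsp : ∀ᶠ p in nhds (ψ x),
      IsSplitting (H p).transpose (F p) (S p) (W p) (τ p) (G p).transpose := by
    filter_upwards [hnhds hU hxU, hnhds hV hxV,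
      Filter.eventually_all.mpr fun j => hnhds (hNo j) (hxN j), hf0] with p hpU hpV hpN hp0
    have hb := (h.inner (ψ.symm p)).isSplitting (he.toBasisAt hpU) (fun l => s l (ψ.symm p))
      (Module.Basis.mk (hq.linearIndependent _ hpV) (hq.generating _ hpV)) hp0
      (fun l => by rw [Module.Basis.mk_apply, hqs l _ (hpN l)])
    simp only [Module.Basis.mk_apply, he.toBasisAt_coe hpU, ← hcoeff hpU] at hb
    exact hb
  have cH : C2Mat H (ψ x) := fun i j =>
    contDiffAt_form h hU (he.contMDiffOn i) (he.contMDiffOn j) hxU hψ hxψ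
  have hF : ∀ i j, ContDiffAt ℂ ω (fun p => F p i j) (ψ x) := fun i _ =>
    contDiffAt_coeff hU isOpen_univ he hf hxU (Set.mem_univ x) hψ hxψ i
  have hS : ∀ i j, ContDiffAt ℂ ω (fun p => S p i j) (ψ x) := fun i l =>
    contDiffAt_coeff hU (hNo l) he (hs l) hxU (hxN l) hψ hxψ i
  have cF := c2Mat_of_contDiffAt_complex hF
  have cS := c2Mat_of_contDiffAt_complex hS
  have cτ : C2Mat τ (ψ x) := fun _ k =>
    (cff.inv hff).mul (contDiffAt_form h hU (he.contMDiffOn k) hfU hxU hψ hxψ)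
  have cW : C2Mat W (ψ x) :=
    (cS.sub (cF.mul (cτ.mul cS))).congr (hsp.mono fun p hp => hp.W_eq)
  -- Regularity of the quotient metric is derived from `g = S* h W`.
  have cG : C2Mat G (ψ x) :=
    C2Mat.congr (cS.conjTranspose.mul (cH.transpose.mul cW)).transpose
      (hsp.mono fun p hp => by beta_reduce; rw [← hp.g_eq, Matrix.transpose_transpose])
  have hp := hsp.self_of_nhds
  obtain ⟨c, hc⟩ := quot_curvature hsp cH cF cS cτ cW
    (diffMat_chernConnection cH (by simpa only [Matrix.det_transpose] using hp.isUnit_h))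
    (diffMat_chernConnection cG (by simpa only [Matrix.det_transpose] using hp.isUnit_g))
    (eventually_gradMat_part01_eq_zero hF) (eventually_gradMat_part01_eq_zero hS)
  set ξ : Fin m → Cot n := fun j =>
    fderiv ℝ (fun p => he.coeff j (ψ.symm p) (f (ψ.symm p))) (ψ x)
      + ∑ k, he.coeff k x (f x) • chernConnection H (ψ x) j k
  set η : Fin m → Cot n := fun k =>
    delbar (fun p => sigma h f (ψ.symm p) (e k (ψ.symm p))) (ψ x)
  have hFx : ∀ k, F (ψ x) k 0 = he.coeff k x (f x) := fun k =>
    congrArg (fun y => he.coeff k y (f y)) hinv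
  have hWx : ∀ k l, W (ψ x) k l = he.coeff k x ((h.inner x).proj (f x) (s l x)) := fun k l =>
    congrArg (fun y => he.coeff k y ((h.inner y).proj (f y) (s l y))) hinv
  -- A column times a row: the matrix with entries `ξ_j ∧ η_k`.
  have hprod : covMat (gradMat LinearMap.id F (ψ x) + smulR (chernConnection H (ψ x)) (F (ψ x)))
      * covMat (gradMat (part01ₗ n) τ (ψ x))
      = Matrix.of fun j k => oneForm (ξ j) * oneForm (η k) := by
    ext1 j k
    rw [Matrix.mul_apply, Fin.sum_univ_one]
    change oneForm (fderiv ℝ (fun p => F p j 0) (ψ x)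
        + ∑ l, F (ψ x) l 0 • chernConnection H (ψ x) j l)
      * oneForm (part01ₗ n (fderiv ℝ (fun p => τ p 0 k) (ψ x))) = oneForm (ξ j) * oneForm (η k)
    simp only [hFx, part01ₗ_apply]
    rfl
  rw [hprod] at hc
  let qb := Module.Basis.mk (hq.linearIndependent x hxV) (hq.generating x hxV)
  have hqb : ∀ l, qb l = Submodule.Quotient.mk (s l x) := fun l => by
    rw [Module.Basis.mk_apply, hqs l x (hxN l)]
  -- The adapted basis at `x` is `f x` followed by the projections of the lifts, so its coordinate
  -- columns are `F` and `W` at `ψ x`.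
  have key := detForm_eq_berezin (he.toBasisAt hxU)
    ((h.inner x).splitBasis (fun l => s l x) qb hfx hqb)
    (curvature_mem_center _ _) (curvature_mem_center _ _) (F := F (ψ x)) (S := W (ψ x))
    (fun i => by rw [HermInner.splitBasis_zero, hFx, hcoeff hxU]; rfl)
    (fun i l => by rw [HermInner.splitBasis_succ, hWx, hcoeff hxU]; rfl) hc
  rw [HermInner.splitBasis_zero, HermInner.splitBasis_coord_zero] at key
  exact key
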